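/- Write an interval as $I=[a,a+L)$, let $I^-$, $I^+$ be its left and right halves (and $I^{+-}=(I^+)^-$, etc.), and let $\mathcal D(I)$ be the family of dyadic subintervals of $I$ (the smallest family containing $I$ and closed under taking halves). Put $I_0=I$, $I_{m+1}=I_m^{++}$. For an integer $k\ge 2$ let $$\varepsilon=4^{-k},\qquad \tau=\frac{9\varepsilon}{1+5\varepsilon},\qquad p=\frac{\frac23(1-\varepsilon)+2\varepsilon\tau}{4\varepsilon}.$$ For $\omega,\sigma>0$ with $\omega\sigma=p$ define weights on $I$ recursively by $$w_0(\omega,\sigma,I)=\frac{\omega}{\sqrt p}\Big((\sqrt p-\sqrt{p-1})\chi_{I^-}+(\sqrt p+\sqrt{p-1})\chi_{I^+}\Big),$$ $$w_n(\omega,\sigma,I)=\sum_{m=0}^{k-2}w_{n-1}\big(3\omega,\tfrac{\sigma}{3},I_m^{+-}\big)+\frac{\omega}{p}\Big(\sum_{m=0}^{k-2}\chi_{I_m^-}+\chi_{I_{k-1}^-}+\tau\,\chi_{I_{k-1}^+}\Big)\qquad(n\ge1).$$ Take $I=[0,1)$, $\omega=1$, $\sigma=p$, $n=4^k$ and write $w_n=w_n(1,p,[0,1))$.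 Let $M^df(x)=\sup\{\frac1{|J|}\int_J|f|\,dy:\ J\in\mathcal D(I),\ x\in J\}$ be the dyadic maximal operator on $I$, let $\|M^d\|_{w_n^{-1}}$ be its norm as an operator from $L^2(I,w_n^{-1}dx)$ to itself, and let $$[w]_{A_2^d}=\sup_{J\in\mathcal D(I)}\Big(\frac1{|J|}\int_Jw\,dx\Big)\Big(\frac1{|J|}\int_Jw^{-1}\,dx\Big).$$ **Theorem.** There is a finite absolute constant $A$ such that for all $k\ge2$ $$\|M^d:L^2(w_n^{-1})\to L^2(w_n^{-1})\|\le A\,p .$$ Moreover, $[w_n]_{A_2^d}\asymp p^2\asymp\|M^d\|_{w_n^{-1}}^2$: there are absolute constants $0<c\le C<\infty$ such that for all $k\ge2$ both $[w_n]_{A_2^d}$ and $\|M^d\|_{w_n^{-1}}^2$ lie between $c\,p^2$ and $C\,p^2$. -/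

import Mathlib

open MeasureTheory Set
open scoped ENNReal

/-- The half-open interval `[left, left + len)`, given by its left endpoint and its length. -/
structure HOInterval where
  left : ℝ
  len : ℝ

namespace HOInterval

/-- The set of points of the interval `[left, left + len)`. -/
def toSet (I : HOInterval) : Set ℝ := Ico I.left (I.left + I.len)

/-- The left half `I^-`. -/
noncomputable def minus (I : HOInterval) : HOInterval := ⟨I.left, I.len / 2⟩

/-- The right half `I^+`. -/
noncomputable def plus (I : HOInterval) : HOInterval := ⟨I.left + I.len / 2, I.len / 2⟩

/-- `I_0 = I` and `I_{m+1} = (I_m)^{++}`. -/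
noncomputable def nest (I : HOInterval) : ℕ → HOInterval
  | 0 => I
  | m + 1 => (I.nest m).plus.plus

/-- The characteristic function of the interval. -/
noncomputable def chi (I : HOInterval) : ℝ → ℝ := I.toSet.indicator fun _ => 1

/-- `I.Dyadic J`: the interval `J` belongs to `D(I)`, the family of dyadic subintervals of `I`,
that is, the smallest family that contains `I` and is closed under taking halves. -/
inductive Dyadic (I : HOInterval) : HOInterval → Prop
  | self : Dyadic I I
  | minus (J : HOInterval) : Dyadic I J → Dyadic I J.minus
  | plus (J : HOInterval) : Dyadic I J → Dyadic I J.plus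

end HOInterval

/-- The interval `[0, 1)`. -/
def unitInt : HOInterval := ⟨0, 1⟩

namespace DyadicWeight

/-- `ε = 4^{-k}`. -/
noncomputable def eps (k : ℕ) : ℝ := ((4 : ℝ) ^ k)⁻¹

/-- `τ(ε) = 9ε / (1 + 5ε)`. -/
noncomputable def tau (k : ℕ) : ℝ := 9 * eps k / (1 + 5 * eps k)

/-- The number `p`, the solution of `(2/3 (1 - ε) + 2 ε τ) / p = 4 ε`; this is the equation that
makes the average of each weight `w_n(ω, σ, I)` over `I` equal to `ω`. -/
noncomputable def pp (k : ℕ) : ℝ := (2 / 3 * (1 - eps k) + 2 * eps k * tau k) / (4 * eps k)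

/-- The weight `w_n(ω, σ, I)`, where `σ` is the number with `ω σ = p`, so that it need not be an
argument (for `w_{n-1}(3ω, σ/3, ·)` the product is again `p`). It vanishes off `I`.
The sums over `m` run over `0 ≤ m ≤ k - 2`. -/
noncomputable def w (k : ℕ) : ℕ → ℝ → HOInterval → ℝ → ℝ
  | 0, ω, I => fun x =>
      ω / √(pp k) * ((√(pp k) - √(pp k - 1)) * I.minus.chi x
        + (√(pp k) + √(pp k - 1)) * I.plus.chi x)
  | n + 1, ω, I => fun x =>
      ∑ m ∈ Finset.range (k - 1), w k n (3 * ω) (I.nest m).plus.minus x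
        + ω / pp k * (∑ m ∈ Finset.range (k - 1), (I.nest m).minus.chi x
          + (I.nest (k - 1)).minus.chi x + tau k * (I.nest (k - 1)).plus.chi x)

end DyadicWeight

/-- The dyadic characteristic `[w]_{A_2^d(I)}`, the supremum over `J ∈ D(I)` of
`⟨w⟩_J ⟨w⁻¹⟩_J`, as an extended nonnegative number. -/
noncomputable def dyadicA2 (I : HOInterval) (w : ℝ → ℝ) : ℝ≥0∞ :=
  ⨆ (J : HOInterval) (_ : I.Dyadic J),
    laverage (volume.restrict J.toSet) (fun x => ENNReal.ofReal (w x)) *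
      laverage (volume.restrict J.toSet) (fun x => (ENNReal.ofReal (w x))⁻¹)

/-- The dyadic maximal function `M^d f (x)`, the supremum of `⟨|f|⟩_J` over `J ∈ D(I)`
with `x ∈ J`. -/
noncomputable def dyadicMax (I : HOInterval) (f : ℝ → ℝ) (x : ℝ) : ℝ≥0∞ :=
  ⨆ (J : HOInterval) (_ : I.Dyadic J) (_ : x ∈ J.toSet),
    laverage (volume.restrict J.toSet) (fun y => ‖f y‖ₑ)

/-- The measure `w⁻¹ dx` on `I`. -/
noncomputable def invMeasure (I : HOInterval) (w : ℝ → ℝ) : Measure ℝ :=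
  (volume.restrict I.toSet).withDensity fun x => (ENNReal.ofReal (w x))⁻¹

/-- The norm of `M^d : L²(I, w⁻¹) → L²(I, w⁻¹)`: the least constant `C` (possibly `∞`) with
`‖M^d f‖ ≤ C ‖f‖` for every `f ∈ L²(I, w⁻¹)`. -/
noncomputable def dyadicMaxNorm (I : HOInterval) (w : ℝ → ℝ) : ℝ≥0∞ :=
  sInf {C : ℝ≥0∞ | ∀ f : ℝ → ℝ, MemLp f 2 (invMeasure I w) →
    eLpNorm (dyadicMax I f) 2 (invMeasure I w) ≤ C * eLpNorm f 2 (invMeasure I w)}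

/-! Two inequalities reduce everything to an upper bound for the norm and a lower bound for the
characteristic. Testing `M^d` on `f = w χ_J` gives `[w]_{A_2^d} ≤ ‖M^d‖²`
(`dyadicA2_le_dyadicMaxNorm_sq`). Conversely, a Sawyer type theorem
(`lintegral_dyadicSup_avg_sq_le`) gives `‖M^d‖² ≤ 32 K` as soon as `∫_J (M^d(w χ_J))² w⁻¹ ≤ K w(J)`
for all dyadic `J`. Here `K = 3 p 4^k`, which is of order `p²` because `p` is comparable with `4^k`.

The testing condition rests on the self-similarity of the weight. On `I` the averages of `w_n` and
`w_n⁻¹` are `ω` and `p/ω`. Along the chain `I_m` the average of `w_n` is at most `ω` and that over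
`I_m^+` is at most `2ω`, while the copies on `I_m^{+-}` have average `3ω`. Truncating the maximal
function from below at `2ω` therefore absorbs the averages over the chain and changes nothing on the
copies. If the testing integral of each copy is at most `p 4^k` times its mass, the copies in `I`
contribute `p 4^k · 3ω · (|I|/4) Σ_{m<k-1} 4^{-m} = p ω (4^k - 4) |I|`, and the rest contributes at
most `(2ω)² (p/ω) |I| = 4 p ω |I|`. The sum is `p 4^k ω |I|`, so the same constant reproduces itself
and the bound is uniform in `n`. This is `maxTest_nest_le` and `lintegral_dyadicSup_le`; `testing`
extends it to all dyadic intervals.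

For the lower bound, on `I_{k-2}` the average of the weight is still of order `ω`, but that of the
inverse is already of order `4^k p/ω` (`exists_le_avg_mul_avg`). -/

namespace HOInterval

/-! ### Dyadic intervals and suprema over them. -/

theorem measurableSet_toSet (I : HOInterval) : MeasurableSet I.toSet := measurableSet_Ico

theorem volume_toSet (I : HOInterval) : volume I.toSet = ENNReal.ofReal I.len := by
  simp [toSet]

@[simp] theorem len_minus (I : HOInterval) : I.minus.len = I.len / 2 := rfl
@[simp] theorem len_plus (I : HOInterval) : I.plus.len = I.len / 2 := rfl

theorem minus_union_plus (I : HOInterval) : I.minus.toSet ∪ I.plus.toSet = I.toSet := by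
  ext x
  simp only [toSet, minus, plus, mem_union, mem_Ico]
  constructor
  · rintro (⟨h1, h2⟩ | ⟨h1, h2⟩) <;> constructor <;> linarith
  · rintro ⟨h1, h2⟩
    by_cases h : x < I.left + I.len / 2
    · exact Or.inl ⟨h1, h⟩
    · exact Or.inr ⟨not_lt.1 h, by linarith⟩

theorem disjoint_minus_plus (I : HOInterval) : Disjoint I.minus.toSet I.plus.toSet := by
  rw [Set.disjoint_left]
  intro x h1 h2
  simp only [toSet, minus, plus, mem_Ico] at h1 h2
  linarith

theorem minus_subset (I : HOInterval) : I.minus.toSet ⊆ I.toSet :=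
  I.minus_union_plus ▸ subset_union_left

theorem plus_subset (I : HOInterval) : I.plus.toSet ⊆ I.toSet :=
  I.minus_union_plus ▸ subset_union_right

theorem lintegral_halves (I : HOInterval) (g : ℝ → ℝ≥0∞) :
    ∫⁻ x in I.toSet, g x = (∫⁻ x in I.minus.toSet, g x) + ∫⁻ x in I.plus.toSet, g x := by
  rw [← lintegral_union I.plus.measurableSet_toSet I.disjoint_minus_plus, minus_union_plus]

/-- `J` is one of the two halves of `I`. -/
def IsHalf (I J : HOInterval) : Prop := J = I.minus ∨ J = I.plus

theorem dyadic_iff {I J : HOInterval} : I.Dyadic J ↔ Relation.ReflTransGen IsHalf I J := by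
  constructor
  · intro h
    induction h with
    | self => exact .refl
    | minus J _ ih => exact ih.tail (Or.inl rfl)
    | plus J _ ih => exact ih.tail (Or.inr rfl)
  · intro h
    induction h with
    | refl => exact .self
    | tail _ h ih =>
      rcases h with rfl | rfl
      · exact .minus _ ih
      · exact .plus _ ih

theorem Dyadic.trans {I J K : HOInterval} (h : I.Dyadic J) (h' : J.Dyadic K) : I.Dyadic K :=
  dyadic_iff.2 ((dyadic_iff.1 h).trans (dyadic_iff.1 h'))

theorem dyadic_minus (I : HOInterval) : I.Dyadic I.minus := .minus _ .self
theorem dyadic_plus (I : HOInterval) : I.Dyadic I.plus := .plus _ .self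

theorem dyadic_cases {I J : HOInterval} (h : I.Dyadic J) :
    J = I ∨ I.minus.Dyadic J ∨ I.plus.Dyadic J := by
  rcases (dyadic_iff.1 h).cases_head with h | ⟨K, hK, h⟩
  · exact Or.inl h.symm
  · rcases hK with rfl | rfl
    · exact Or.inr (Or.inl (dyadic_iff.2 h))
    · exact Or.inr (Or.inr (dyadic_iff.2 h))

theorem Dyadic.subset {I J : HOInterval} (h : I.Dyadic J) : J.toSet ⊆ I.toSet := by
  induction h with
  | self => exact Subset.rfl
  | minus J _ ih => exact J.minus_subset.trans ih
  | plus J _ ih => exact J.plus_subset.trans ih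

theorem Dyadic.len_pos {I J : HOInterval} (h : I.Dyadic J) (hI : 0 < I.len) : 0 < J.len := by
  induction h with
  | self => exact hI
  | minus J _ ih => simpa using ih
  | plus J _ ih => simpa using ih

/-- The supremum of `φ J` over the dyadic subintervals `J` of `I` that contain `x`. -/
noncomputable def dyadicSup (φ : HOInterval → ℝ≥0∞) (I : HOInterval) (x : ℝ) : ℝ≥0∞ :=
  ⨆ (J : HOInterval) (_ : I.Dyadic J) (_ : x ∈ J.toSet), φ J

/-- The supremum of `φ J` over the dyadic subintervals `J ∋ x` of `I` of generation at most `N`. -/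
noncomputable def truncSup (φ : HOInterval → ℝ≥0∞) : ℕ → HOInterval → ℝ → ℝ≥0∞
  | 0, I => I.toSet.indicator fun _ => φ I
  | N + 1, I => fun x => I.toSet.indicator (fun _ => φ I) x ⊔
      (truncSup φ N I.minus x ⊔ truncSup φ N I.plus x)

theorem le_dyadicSup (φ : HOInterval → ℝ≥0∞) {I J : HOInterval} (h : I.Dyadic J) {x : ℝ}
    (hx : x ∈ J.toSet) : φ J ≤ dyadicSup φ I x :=
  le_iSup_of_le J (le_iSup_of_le h (le_iSup_of_le hx le_rfl))

theorem dyadicSup_le {φ : HOInterval → ℝ≥0∞} {I : HOInterval} {x : ℝ} {c : ℝ≥0∞}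
    (h : ∀ J, I.Dyadic J → x ∈ J.toSet → φ J ≤ c) : dyadicSup φ I x ≤ c :=
  iSup_le fun J => iSup_le fun hJ => iSup_le fun hx => h J hJ hx

theorem dyadicSup_of_dyadic_le (φ : HOInterval → ℝ≥0∞) {I J : HOInterval} (h : I.Dyadic J)
    (x : ℝ) : dyadicSup φ J x ≤ dyadicSup φ I x :=
  dyadicSup_le fun _ hK hx => le_dyadicSup φ (h.trans hK) hx

theorem dyadicSup_minus {φ : HOInterval → ℝ≥0∞} {I : HOInterval} {x : ℝ}
    (hx : x ∈ I.minus.toSet) : dyadicSup φ I x ≤ φ I ⊔ dyadicSup φ I.minus x := by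
  refine dyadicSup_le fun J hJ hxJ => ?_
  rcases dyadic_cases hJ with rfl | h | h
  · exact le_sup_left
  · exact (le_dyadicSup φ h hxJ).trans le_sup_right
  · exact absurd (h.subset hxJ) (Set.disjoint_left.1 I.disjoint_minus_plus hx)

theorem dyadicSup_plus {φ : HOInterval → ℝ≥0∞} {I : HOInterval} {x : ℝ}
    (hx : x ∈ I.plus.toSet) : dyadicSup φ I x ≤ φ I ⊔ dyadicSup φ I.plus x := by
  refine dyadicSup_le fun J hJ hxJ => ?_
  rcases dyadic_cases hJ with rfl | h | h
  · exact le_sup_left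
  · exact absurd hx (Set.disjoint_left.1 I.disjoint_minus_plus (h.subset hxJ))
  · exact (le_dyadicSup φ h hxJ).trans le_sup_right

theorem truncSup_le_dyadicSup (φ : HOInterval → ℝ≥0∞) (N : ℕ) (I : HOInterval) (x : ℝ) :
    truncSup φ N I x ≤ dyadicSup φ I x := by
  induction N generalizing I with
  | zero => exact indicator_le (fun y hy => le_dyadicSup φ .self hy) x
  | succ N ih =>
    refine sup_le (indicator_le (fun y hy => le_dyadicSup φ .self hy) x) (sup_le ?_ ?_)
    · exact (ih _).trans (dyadicSup_of_dyadic_le φ I.dyadic_minus x)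
    · exact (ih _).trans (dyadicSup_of_dyadic_le φ I.dyadic_plus x)

theorem le_truncSup (φ : HOInterval → ℝ≥0∞) (N : ℕ) (I : HOInterval) {x : ℝ}
    (hx : x ∈ I.toSet) : φ I ≤ truncSup φ N I x := by
  cases N with
  | zero => simp [truncSup, hx]
  | succ N => exact le_sup_of_le_left (by simp [hx])

theorem truncSup_mono (φ : HOInterval → ℝ≥0∞) (I : HOInterval) (x : ℝ) :
    Monotone fun N => truncSup φ N I x := by
  refine monotone_nat_of_le_succ fun N => ?_
  induction N generalizing I with
  | zero => exact le_sup_left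
  | succ N ih => exact sup_le_sup le_rfl (sup_le_sup (ih _) (ih _))

theorem truncSup_eq_zero (φ : HOInterval → ℝ≥0∞) (N : ℕ) {I : HOInterval} {x : ℝ}
    (hx : x ∉ I.toSet) : truncSup φ N I x = 0 := by
  refine le_antisymm ((truncSup_le_dyadicSup φ N I x).trans ?_) zero_le
  exact dyadicSup_le fun J hJ hxJ => absurd (hJ.subset hxJ) hx

theorem measurable_truncSup (φ : HOInterval → ℝ≥0∞) (N : ℕ) (I : HOInterval) :
    Measurable (truncSup φ N I) := by
  induction N generalizing I with
  | zero => exact measurable_const.indicator I.measurableSet_toSet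
  | succ N ih =>
    exact (measurable_const.indicator I.measurableSet_toSet).sup ((ih _).sup (ih _))

/-- Every dyadic interval is reached after finitely many halvings. This yields measurability, and
reduces integral estimates to bounded generation by monotone convergence. -/
theorem dyadicSup_eq_iSup (φ : HOInterval → ℝ≥0∞) (I : HOInterval) (x : ℝ) :
    dyadicSup φ I x = ⨆ N, truncSup φ N I x := by
  refine le_antisymm (dyadicSup_le fun J hJ hx => ?_)
    (iSup_le fun N => truncSup_le_dyadicSup φ N I x)
  suffices h : ∃ N, φ J ≤ truncSup φ N I x by
    obtain ⟨N, hN⟩ := h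
    exact hN.trans (le_iSup (fun N => truncSup φ N I x) N)
  refine Relation.ReflTransGen.head_induction_on (dyadic_iff.1 hJ) ⟨0, le_truncSup φ 0 J hx⟩ ?_
  rintro A B hAB - ⟨N, hN⟩
  refine ⟨N + 1, hN.trans (le_sup_of_le_right ?_)⟩
  rcases hAB with rfl | rfl
  · exact le_sup_left
  · exact le_sup_right

theorem measurable_dyadicSup (φ : HOInterval → ℝ≥0∞) (I : HOInterval) :
    Measurable (dyadicSup φ I) := by
  have : dyadicSup φ I = fun x => ⨆ N, truncSup φ N I x := funext (dyadicSup_eq_iSup φ I)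
  rw [this]
  exact .iSup fun N => measurable_truncSup φ N I

theorem truncSup_succ_minus {φ : HOInterval → ℝ≥0∞} {I : HOInterval} (h : φ I = 0) (N : ℕ)
    {x : ℝ} (hx : x ∈ I.minus.toSet) : truncSup φ (N + 1) I x = truncSup φ N I.minus x := by
  have := truncSup_eq_zero φ N (Set.disjoint_left.1 I.disjoint_minus_plus hx)
  simp [truncSup, h, this]

theorem truncSup_succ_plus {φ : HOInterval → ℝ≥0∞} {I : HOInterval} (h : φ I = 0) (N : ℕ)
    {x : ℝ} (hx : x ∈ I.plus.toSet) : truncSup φ (N + 1) I x = truncSup φ N I.plus x := by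
  have := truncSup_eq_zero φ N (Set.disjoint_right.1 I.disjoint_minus_plus hx)
  simp [truncSup, h, this]

/-- The average of `g` over `I`. -/
noncomputable def avg (g : ℝ → ℝ≥0∞) (I : HOInterval) : ℝ≥0∞ :=
  laverage (volume.restrict I.toSet) g

theorem avg_eq (g : ℝ → ℝ≥0∞) (I : HOInterval) :
    I.avg g = (∫⁻ x in I.toSet, g x) / ENNReal.ofReal I.len := by
  rw [avg, laverage_eq, Measure.restrict_apply_univ, volume_toSet]

theorem lintegral_truncSup_succ {φ : HOInterval → ℝ≥0∞} {I : HOInterval} (h : φ I = 0) (N : ℕ)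
    (H : ℝ≥0∞ → ℝ → ℝ≥0∞) :
    ∫⁻ x in I.toSet, H (truncSup φ (N + 1) I x) x =
      (∫⁻ x in I.minus.toSet, H (truncSup φ N I.minus x) x) +
        ∫⁻ x in I.plus.toSet, H (truncSup φ N I.plus x) x := by
  rw [lintegral_halves]
  congr 1
  · exact setLIntegral_congr_fun I.minus.measurableSet_toSet fun x hx => by
      rw [truncSup_succ_minus h N hx]
  · exact setLIntegral_congr_fun I.plus.measurableSet_toSet fun x hx => by
      rw [truncSup_succ_plus h N hx]

/-- An inequality between integrals of `truncSup` holds as soon as it holds over the intervals on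
which `P` holds, when both integrands vanish off the intervals selected by `P`. -/
theorem lintegral_truncSup_induction {φ ψ : HOInterval → ℝ≥0∞} {P : HOInterval → Prop}
    (hφ : ∀ J, ¬ P J → φ J = 0) (hψ : ∀ J, ¬ P J → ψ J = 0)
    (G H : ℝ≥0∞ → ℝ → ℝ≥0∞) (hG : ∀ x, G 0 x = 0) (N : ℕ) (I : HOInterval)
    (h : ∀ J, I.Dyadic J → P J → ∀ N, ∫⁻ x in J.toSet, G (truncSup φ N J x) x ≤
      ∫⁻ x in J.toSet, H (truncSup ψ N J x) x) :
    ∫⁻ x in I.toSet, G (truncSup φ N I x) x ≤ ∫⁻ x in I.toSet, H (truncSup ψ N I x) x := by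
  induction N generalizing I with
  | zero =>
    by_cases hP : P I
    · exact h I .self hP 0
    · have : ∀ x, truncSup φ 0 I x = 0 := fun x => by simp [truncSup, hφ I hP]
      simp [this, hG]
  | succ N ih =>
    by_cases hP : P I
    · exact h I .self hP _
    -- Off `P` the top interval contributes nothing to either supremum, so both integrals split over
    -- the halves. The descent stops at the maximal intervals of `P`, so no disjoint family has to
    -- be extracted.
    · rw [lintegral_truncSup_succ (hφ I hP), lintegral_truncSup_succ (hψ I hP)]
      exact add_le_add (ih _ fun J hJ => h J (I.dyadic_minus.trans hJ))
        (ih _ fun J hJ => h J (I.dyadic_plus.trans hJ))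

/-! ### Estimates over the union of the selected intervals. -/

section Selection

variable {W V g : ℝ → ℝ≥0∞} {φ : HOInterval → ℝ≥0∞} (P : HOInterval → Prop) [DecidablePred P]
  (I : HOInterval)

/-- This supremum is the indicator function of the union of the selected intervals; it plays that
role in all the estimates below. -/
theorem dyadicSup_indicator_le_one (J : HOInterval) (x : ℝ) :
    dyadicSup (fun J => if P J then 1 else 0) J x ≤ 1 :=
  dyadicSup_le fun K _ _ => by split_ifs <;> simp

theorem lintegral_le_lintegral_selected (W : ℝ → ℝ≥0∞) {J : HOInterval} (hP : P J) (N : ℕ) :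
    ∫⁻ x in J.toSet, W x ≤
      ∫⁻ x in J.toSet, truncSup (fun J => if P J then 1 else 0) N J x * W x := by
  refine setLIntegral_mono' J.measurableSet_toSet fun x hx => ?_
  have := le_truncSup (fun J => if P J then (1 : ℝ≥0∞) else 0) N J hx
  rw [if_pos hP] at this
  calc W x = 1 * W x := (one_mul _).symm
    _ ≤ _ := by gcongr

/-- On a maximal selected `J` the selected supremum only sees subintervals of `J`, so the testing
hypothesis on `J` applies; the masses of the maximal intervals then add up. -/
theorem lintegral_truncSup_selected_le {K : ℝ≥0∞} (hW : Measurable W)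
    (h : ∀ J, I.Dyadic J → P J →
      ∫⁻ x in J.toSet, dyadicSup φ J x ^ 2 * V x ≤ K * ∫⁻ x in J.toSet, W x) (N : ℕ) :
    ∫⁻ x in I.toSet, truncSup (fun J => if P J then φ J else 0) N I x ^ 2 * V x ≤
      K * ∫⁻ x in I.toSet, truncSup (fun J => if P J then 1 else 0) N I x * W x := by
  have hm : ∀ (J : HOInterval) (N : ℕ),
      K * ∫⁻ x in J.toSet, truncSup (fun J => if P J then 1 else 0) N J x * W x =
      ∫⁻ x in J.toSet, K * (truncSup (fun J => if P J then 1 else 0) N J x * W x) :=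
    fun J N => (lintegral_const_mul _ ((measurable_truncSup _ _ _).mul hW)).symm
  rw [hm]
  refine lintegral_truncSup_induction (P := P) (by simp +contextual) (by simp +contextual)
    (fun t x => t ^ 2 * V x) (fun t x => K * (t * W x)) (by simp) N I fun J hJ hP N => ?_
  rw [← hm]
  calc _ ≤ ∫⁻ x in J.toSet, dyadicSup φ J x ^ 2 * V x := by
        refine lintegral_mono fun x => ?_
        dsimp only
        gcongr
        refine (truncSup_le_dyadicSup _ N J x).trans (dyadicSup_le fun L hL hx => ?_)
        split_ifs
        · exact le_dyadicSup φ hL hx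
        · exact zero_le
    _ ≤ _ := h J hJ hP
    _ ≤ _ := mul_le_mul_right (lintegral_le_lintegral_selected P W hP N) _

theorem mul_lintegral_truncSup_le {c : ℝ≥0∞} (hW : Measurable W)
    (h : ∀ J, I.Dyadic J → P J → c * ∫⁻ x in J.toSet, W x ≤ ∫⁻ x in J.toSet, g x) (N : ℕ) :
    c * ∫⁻ x in I.toSet, truncSup (fun J => if P J then 1 else 0) N I x * W x ≤
      ∫⁻ x in I.toSet, truncSup (fun J => if P J then 1 else 0) N I x * g x := by
  have hm : ∀ (J : HOInterval) (N : ℕ),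
      c * ∫⁻ x in J.toSet, truncSup (fun J => if P J then 1 else 0) N J x * W x =
      ∫⁻ x in J.toSet, c * (truncSup (fun J => if P J then 1 else 0) N J x * W x) :=
    fun J N => (lintegral_const_mul _ ((measurable_truncSup _ _ _).mul hW)).symm
  rw [hm]
  refine lintegral_truncSup_induction (P := P) (by simp +contextual) (by simp +contextual)
    (fun t x => c * (t * W x)) (fun t x => t * g x) (by simp) N I fun J hJ hP N => ?_
  rw [← hm]
  calc _ ≤ c * ∫⁻ x in J.toSet, W x := by
        refine mul_le_mul_right (lintegral_mono fun x => ?_) _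
        refine (mul_le_mul_left ((truncSup_le_dyadicSup _ N J x).trans
          (dyadicSup_indicator_le_one P J x)) _).trans (one_mul _).le
    _ ≤ _ := h J hJ hP
    _ ≤ _ := lintegral_le_lintegral_selected P g hP N

theorem lintegral_dyadicSup_eq_iSup (ψ : HOInterval → ℝ≥0∞) (hV : Measurable V)
    (F : ℝ≥0∞ → ℝ≥0∞) (hF : Monotone F) (hF0 : F 0 = 0) (hFc : Continuous F) :
    ∫⁻ x in I.toSet, F (dyadicSup ψ I x) * V x =
      ⨆ N, ∫⁻ x in I.toSet, F (truncSup ψ N I x) * V x := by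
  rw [← lintegral_iSup]
  · refine lintegral_congr fun x => ?_
    rw [← ENNReal.iSup_mul, dyadicSup_eq_iSup]
    congr 1
    exact hF.map_iSup_of_continuousAt hFc.continuousAt hF0
  · exact fun N => (hFc.measurable.comp (measurable_truncSup _ _ _)).mul hV
  · intro N M hNM x
    exact mul_le_mul_left (hF (truncSup_mono ψ I x hNM)) _

theorem lintegral_dyadicSup_selected_le {K : ℝ≥0∞} (hW : Measurable W) (hV : Measurable V)
    (h : ∀ J, I.Dyadic J → P J →
      ∫⁻ x in J.toSet, dyadicSup φ J x ^ 2 * V x ≤ K * ∫⁻ x in J.toSet, W x) :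
    ∫⁻ x in I.toSet, dyadicSup (fun J => if P J then φ J else 0) I x ^ 2 * V x ≤
      K * ∫⁻ x in I.toSet, dyadicSup (fun J => if P J then 1 else 0) I x * W x := by
  rw [lintegral_dyadicSup_eq_iSup I _ hV (fun t => t ^ 2)
    (fun _ _ h => pow_le_pow_left' h 2) (by simp) (by fun_prop)]
  refine iSup_le fun N => (lintegral_truncSup_selected_le P I hW h N).trans ?_
  refine mul_le_mul_right (lintegral_mono fun x => ?_) _
  exact mul_le_mul_left (truncSup_le_dyadicSup _ N I x) _

theorem mul_lintegral_dyadicSup_le {c : ℝ≥0∞} (hW : Measurable W)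
    (h : ∀ J, I.Dyadic J → P J → c * ∫⁻ x in J.toSet, W x ≤ ∫⁻ x in J.toSet, g x) :
    c * ∫⁻ x in I.toSet, dyadicSup (fun J => if P J then 1 else 0) I x * W x ≤
      ∫⁻ x in I.toSet, dyadicSup (fun J => if P J then 1 else 0) I x * g x := by
  rw [lintegral_dyadicSup_eq_iSup I _ hW (fun t => t) monotone_id rfl continuous_id,
    ENNReal.mul_iSup]
  refine iSup_le fun N => (mul_lintegral_truncSup_le P I hW h N).trans ?_
  refine lintegral_mono fun x => ?_
  exact mul_le_mul_left (truncSup_le_dyadicSup _ N I x) _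

/-- The weak type estimate, with the function truncated from below. -/
theorem mul_lintegral_dyadicSup_le_truncated {a : ℝ≥0∞} (ha : a ≠ ∞) (hW : Measurable W)
    (hfin : ∫⁻ x in I.toSet, W x ≠ ∞)
    (hgW : ∀ᵐ x ∂volume.restrict I.toSet, g x * V x ≤ a → g x ≤ a * W x)
    (h : ∀ J, I.Dyadic J → P J → 2 * a * ∫⁻ x in J.toSet, W x ≤ ∫⁻ x in J.toSet, g x) :
    a * ∫⁻ x in I.toSet, dyadicSup (fun J => if P J then 1 else 0) I x * W x ≤
      ∫⁻ x in I.toSet, if a < g x * V x then g x else 0 := by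
  set X := ∫⁻ x in I.toSet, dyadicSup (fun J => if P J then 1 else 0) I x * W x with hX
  have hmX : Measurable fun x => dyadicSup (fun J => if P J then 1 else 0) I x * W x :=
    (measurable_dyadicSup _ _).mul hW
  have hXfin : X ≠ ∞ := by
    refine ne_top_of_le_ne_top hfin (lintegral_mono fun x => ?_)
    exact (mul_le_mul_left (dyadicSup_indicator_le_one P I x) _).trans (one_mul _).le
  have h1 := mul_lintegral_dyadicSup_le P I hW h
  -- Where `g ≤ a W` the contribution is at most `a * X`, half of the left side of `h1`. It can be
  -- subtracted because `X` is finite.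
  have h2 : ∫⁻ x in I.toSet, dyadicSup (fun J => if P J then 1 else 0) I x * g x ≤
      (∫⁻ x in I.toSet, if a < g x * V x then g x else 0) + a * X := by
    rw [hX, ← lintegral_const_mul _ hmX, ← lintegral_add_right _ (hmX.const_mul a)]
    refine lintegral_mono_ae ?_
    filter_upwards [hgW] with x hx
    set t := dyadicSup (fun J => if P J then 1 else 0) I x
    have ht : t ≤ 1 := dyadicSup_indicator_le_one P I x
    split_ifs with hc
    · exact le_add_right ((mul_le_mul_left ht _).trans (one_mul _).le)
    · rw [zero_add]
      calc t * g x ≤ t * (a * W x) := by gcongr; exact hx (not_lt.1 hc)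
        _ = _ := by ring
  have h3 : a * X + a * X ≤ (∫⁻ x in I.toSet, if a < g x * V x then g x else 0) + a * X := by
    refine le_trans (le_of_eq ?_) (h1.trans h2)
    rw [← two_mul, mul_assoc]
  exact (ENNReal.add_le_add_iff_right (ENNReal.mul_ne_top ha hXfin)).1 h3

end Selection

/-! ### Dyadic level sums and the two weight theorem. -/

/-- For `2^n < r ≤ 2^(n+1)` the single term `l = n - 1` suffices, and `(2^(n+1))² = 16 (2^(n-1))²`.
-/
theorem sq_le_tsum_zpow (r : ℝ≥0∞) :
    r ^ 2 ≤ 16 * ∑' l : ℤ, if 2 * (2 : ℝ≥0∞) ^ l < r then ((2 : ℝ≥0∞) ^ l) ^ 2 else 0 := by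
  rcases eq_or_ne r 0 with rfl | h0
  · simp
  rcases eq_or_ne r ∞ with rfl | h1
  · have hlt : ∀ l : ℤ, 2 * (2 : ℝ≥0∞) ^ l < ∞ := fun l =>
      ENNReal.mul_lt_top (by simp) (ENNReal.zpow_lt_top (by simp) (by simp) l)
    simp only [hlt, if_true]
    have : (∑' l : ℤ, ((2 : ℝ≥0∞) ^ l) ^ 2) = ∞ := by
      rw [eq_top_iff]
      calc (∞ : ℝ≥0∞) = ∑' _ : ℕ, 1 := (ENNReal.tsum_const_eq_top_of_ne_zero one_ne_zero).symm
        _ ≤ ∑' n : ℕ, ((2 : ℝ≥0∞) ^ (n : ℤ)) ^ 2 := by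
            refine ENNReal.tsum_le_tsum fun n => ?_
            rw [zpow_natCast, ← pow_mul]
            exact one_le_pow₀ (by norm_num)
        _ ≤ _ := ENNReal.tsum_comp_le_tsum_of_injective Nat.cast_injective _
    simp [this]
  obtain ⟨n, hn, hn'⟩ := ENNReal.exists_mem_Ioc_zpow h0 h1 (y := 2) (by norm_num) (by simp)
  have e : ∀ m : ℤ, (2 : ℝ≥0∞) ^ (m + 1) = 2 * 2 ^ m := fun m => by
    rw [ENNReal.zpow_add (by simp) (by simp), zpow_one, mul_comm]
  have e1 : 2 * (2 : ℝ≥0∞) ^ (n - 1) = 2 ^ n := by rw [← e, sub_add_cancel]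
  calc r ^ 2 ≤ ((2 : ℝ≥0∞) ^ (n + 1)) ^ 2 := by gcongr
    _ = 16 * ((2 : ℝ≥0∞) ^ (n - 1)) ^ 2 := by rw [e, ← e1]; ring
    _ = 16 * if 2 * (2 : ℝ≥0∞) ^ (n - 1) < r then ((2 : ℝ≥0∞) ^ (n - 1)) ^ 2 else 0 := by
        rw [e1, if_pos hn]
    _ ≤ _ := mul_le_mul_right (ENNReal.le_tsum
        (f := fun l : ℤ => if 2 * (2 : ℝ≥0∞) ^ l < r then ((2 : ℝ≥0∞) ^ l) ^ 2 else 0) (n - 1)) _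

theorem tsum_zpow_le (r : ℝ≥0∞) :
    ∑' l : ℤ, (if (2 : ℝ≥0∞) ^ l < r then (2 : ℝ≥0∞) ^ l else 0) ≤ 2 * r := by
  rcases eq_or_ne r 0 with rfl | h0
  · simp
  rcases eq_or_ne r ∞ with rfl | h1
  · simp
  obtain ⟨n, hn, hn'⟩ := ENNReal.exists_mem_Ioc_zpow h0 h1 (y := 2) (by norm_num) (by simp)
  have hinj : Function.Injective fun j : ℕ => n - (j : ℤ) := fun i j h => by
    simpa using h
  have hsupp : Function.support (fun l : ℤ => if (2 : ℝ≥0∞) ^ l < r then (2 : ℝ≥0∞) ^ l else 0) ⊆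
      Set.range fun j : ℕ => n - (j : ℤ) := by
    intro l hl
    have hlr : (2 : ℝ≥0∞) ^ l < r := by
      by_contra h
      simp [h] at hl
    have hln : l ≤ n := by
      by_contra! h
      have : (2 : ℝ≥0∞) ^ (n + 1) ≤ 2 ^ l := ENNReal.zpow_le_of_le (by norm_num) h
      exact absurd hlr (not_lt.2 (hn'.trans this))
    exact ⟨(n - l).toNat, by simp [Int.toNat_of_nonneg (sub_nonneg.2 hln)]⟩
  rw [← hinj.tsum_eq hsupp]
  calc _ ≤ ∑' j : ℕ, (2 : ℝ≥0∞) ^ n * 2⁻¹ ^ j := by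
        refine ENNReal.tsum_le_tsum fun j => ?_
        split_ifs
        · rw [sub_eq_add_neg, ENNReal.zpow_add (by simp) (by simp), ENNReal.zpow_neg,
            zpow_natCast, ENNReal.inv_pow]
        · exact zero_le
    _ = 2 * 2 ^ n := by
        rw [ENNReal.tsum_mul_left, ENNReal.tsum_geometric, ENNReal.one_sub_inv_two, inv_inv,
          mul_comm]
    _ ≤ 2 * r := mul_le_mul_right hn.le _

theorem lintegral_dyadic_ne_zero {W : ℝ → ℝ≥0∞} (hW : Measurable W) {I J : HOInterval}
    (hI : 0 < I.len) (hW0 : ∀ᵐ x ∂volume.restrict I.toSet, W x ≠ 0) (hJ : I.Dyadic J) :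
    ∫⁻ x in J.toSet, W x ≠ 0 := fun h0 => by
  rw [lintegral_eq_zero_iff hW] at h0
  have h1 := ae_restrict_of_ae_restrict_of_subset hJ.subset hW0
  have h2 : ∀ᵐ x ∂volume.restrict J.toSet, False := by
    filter_upwards [h0, h1] with x a b using b a
  rw [Filter.eventually_false_iff_eq_bot, ae_eq_bot, Measure.restrict_eq_zero, volume_toSet,
    ENNReal.ofReal_eq_zero] at h2
  exact absurd (hJ.len_pos hI) (not_lt.2 h2)

/-- The average of `g` over `J` is that of `W` times the ratio `g(J)/W(J)`. The square of the ratio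
is spread over the levels `l` it exceeds, which are those that select `J`. -/
theorem dyadicSup_avg_sq_le {W g : ℝ → ℝ≥0∞} {I : HOInterval}
    (hpos : ∀ J, I.Dyadic J → ∫⁻ x in J.toSet, W x ≠ 0)
    (hfin : ∀ J, I.Dyadic J → ∫⁻ x in J.toSet, W x ≠ ∞)
    [∀ l : ℤ, DecidablePred fun J : HOInterval =>
      2 * (2 : ℝ≥0∞) ^ l * ∫⁻ x in J.toSet, W x < ∫⁻ x in J.toSet, g x] (x : ℝ) :
    dyadicSup (avg g) I x ^ 2 ≤ 16 * ∑' l : ℤ, ((2 : ℝ≥0∞) ^ l) ^ 2 *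
      dyadicSup (fun J => if 2 * (2 : ℝ≥0∞) ^ l * ∫⁻ x in J.toSet, W x < ∫⁻ x in J.toSet, g x
        then avg W J else 0) I x ^ 2 := by
  -- As a square root, the right side bounds the supremum once it bounds each average separately.
  have key : dyadicSup (avg g) I x ≤ (16 * ∑' l : ℤ, ((2 : ℝ≥0∞) ^ l) ^ 2 *
      dyadicSup (fun J => if 2 * (2 : ℝ≥0∞) ^ l * ∫⁻ x in J.toSet, W x < ∫⁻ x in J.toSet, g x
        then avg W J else 0) I x ^ 2) ^ (2⁻¹ : ℝ) := by
    refine dyadicSup_le fun J hJ hx => ?_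
    rw [ENNReal.le_rpow_inv_iff (by norm_num), ENNReal.rpow_two]
    have e : avg g J = ((∫⁻ x in J.toSet, g x) / ∫⁻ x in J.toSet, W x) * avg W J := by
      rw [avg_eq, avg_eq, ← mul_div_assoc, ENNReal.div_mul_cancel (hpos J hJ) (hfin J hJ)]
    rw [e, mul_pow]
    refine (mul_le_mul_left (sq_le_tsum_zpow _) _).trans ?_
    rw [mul_assoc, ← ENNReal.tsum_mul_right]
    refine mul_le_mul_right (ENNReal.tsum_le_tsum fun l => ?_) _
    have hiff := ENNReal.lt_div_iff_mul_lt (c := 2 * (2 : ℝ≥0∞) ^ l) (a := ∫⁻ x in J.toSet, g x)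
      (Or.inl (hpos J hJ)) (Or.inl (hfin J hJ))
    have hle := le_dyadicSup (fun J => if 2 * (2 : ℝ≥0∞) ^ l * ∫⁻ x in J.toSet, W x <
      ∫⁻ x in J.toSet, g x then avg W J else 0) hJ hx
    split_ifs with h1
    · rw [if_pos (hiff.1 h1)] at hle
      gcongr
    · simp
  calc _ ≤ _ := pow_le_pow_left' key 2
    _ = _ := by rw [← ENNReal.rpow_two, ← ENNReal.rpow_mul]; norm_num

/-- The dyadic two weight maximal theorem: the testing condition on the dyadic intervals implies
the boundedness of the dyadic maximal operator. -/
theorem lintegral_dyadicSup_avg_sq_le {W g : ℝ → ℝ≥0∞} (hW : Measurable W) (hg : Measurable g)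
    {I : HOInterval} (hI : 0 < I.len) (hfin : ∫⁻ x in I.toSet, W x ≠ ∞)
    (hW0 : ∀ᵐ x ∂volume.restrict I.toSet, W x ≠ 0) {K : ℝ≥0∞}
    (h : ∀ J, I.Dyadic J →
      ∫⁻ x in J.toSet, dyadicSup (avg W) J x ^ 2 * (W x)⁻¹ ≤ K * ∫⁻ x in J.toSet, W x) :
    ∫⁻ x in I.toSet, dyadicSup (avg g) I x ^ 2 * (W x)⁻¹ ≤
      32 * K * ∫⁻ x in I.toSet, g x ^ 2 * (W x)⁻¹ := by
  classical
  have hWt : ∀ᵐ x ∂volume.restrict I.toSet, W x < ∞ := ae_lt_top hW hfin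
  have hfin' : ∀ J, I.Dyadic J → ∫⁻ x in J.toSet, W x ≠ ∞ := fun J hJ =>
    ne_top_of_le_ne_top hfin (lintegral_mono_set hJ.subset)
  have hpos : ∀ J, I.Dyadic J → ∫⁻ x in J.toSet, W x ≠ 0 := fun J hJ =>
    lintegral_dyadic_ne_zero hW hI hW0 hJ
  have hV : Measurable fun x => (W x)⁻¹ := hW.inv
  set P : ℤ → HOInterval → Prop := fun l J =>
    2 * (2 : ℝ≥0∞) ^ l * ∫⁻ x in J.toSet, W x < ∫⁻ x in J.toSet, g x with hP
  set X : ℤ → ℝ≥0∞ := fun l =>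
    ∫⁻ x in I.toSet, dyadicSup (fun J => if P l J then 1 else 0) I x * W x with hX
  have h1 : ∀ l, ∫⁻ x in I.toSet,
      dyadicSup (fun J => if P l J then avg W J else 0) I x ^ 2 * (W x)⁻¹ ≤ K * X l := fun l =>
    lintegral_dyadicSup_selected_le (P l) I hW hV fun J hJ _ => h J hJ
  have h2 : ∀ l : ℤ, (2 : ℝ≥0∞) ^ l * X l ≤
      ∫⁻ x in I.toSet, if (2 : ℝ≥0∞) ^ l < g x * (W x)⁻¹ then g x else 0 := fun l => by
    refine mul_lintegral_dyadicSup_le_truncated (P l) I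
      (ENNReal.zpow_lt_top (by simp) (by simp) l).ne hW hfin ?_ fun J _ hPJ => hPJ.le
    filter_upwards [hW0, hWt] with x a b hx
    rwa [← div_eq_mul_inv, ENNReal.div_le_iff a b.ne] at hx
  calc _ ≤ ∫⁻ x in I.toSet, ∑' l : ℤ, 16 * (((2 : ℝ≥0∞) ^ l) ^ 2 *
        (dyadicSup (fun J => if P l J then avg W J else 0) I x ^ 2 * (W x)⁻¹)) := by
        refine lintegral_mono fun x => ?_
        refine (mul_le_mul_left (dyadicSup_avg_sq_le hpos hfin' x) _).trans (le_of_eq ?_)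
        rw [ENNReal.tsum_mul_left, mul_assoc, ← ENNReal.tsum_mul_right]
        simp only [mul_assoc, hP]
    _ = ∑' l : ℤ, 16 * (((2 : ℝ≥0∞) ^ l) ^ 2 * ∫⁻ x in I.toSet,
        dyadicSup (fun J => if P l J then avg W J else 0) I x ^ 2 * (W x)⁻¹) := by
        have hm : ∀ l, Measurable fun x =>
            dyadicSup (fun J => if P l J then avg W J else 0) I x ^ 2 * (W x)⁻¹ := fun l =>
          ((measurable_dyadicSup _ I).pow_const 2).mul hV
        rw [lintegral_tsum fun l => (((hm l).const_mul _).const_mul _).aemeasurable]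
        refine tsum_congr fun l => ?_
        rw [lintegral_const_mul _ ((hm l).const_mul _), lintegral_const_mul _ (hm l)]
    -- One factor `2^l` is spent on the weak type bound `h2`; the other is summed geometrically
    -- under the integral.
    _ ≤ ∑' l : ℤ, 16 * K * ∫⁻ x in I.toSet,
        (2 : ℝ≥0∞) ^ l * if (2 : ℝ≥0∞) ^ l < g x * (W x)⁻¹ then g x else 0 := by
        refine ENNReal.tsum_le_tsum fun l => ?_
        calc _ ≤ 16 * (((2 : ℝ≥0∞) ^ l) ^ 2 * (K * X l)) :=
              mul_le_mul_right (mul_le_mul_right (h1 l) _) _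
          _ = 16 * K * (2 ^ l * (2 ^ l * X l)) := by ring
          _ ≤ _ := mul_le_mul_right ((mul_le_mul_right (h2 l) _).trans
              (lintegral_const_mul_le _ _)) _
    _ = 16 * K * ∫⁻ x in I.toSet, g x *
        ∑' l : ℤ, if (2 : ℝ≥0∞) ^ l < g x * (W x)⁻¹ then (2 : ℝ≥0∞) ^ l else 0 := by
        rw [ENNReal.tsum_mul_left, ← lintegral_tsum]
        · congr 1
          refine lintegral_congr fun x => ?_
          rw [← ENNReal.tsum_mul_left]
          refine tsum_congr fun l => ?_
          split_ifs <;> simp [mul_comm]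
        · intro l
          exact ((Measurable.ite (measurableSet_lt measurable_const (hg.mul hV)) hg
            measurable_const).const_mul _).aemeasurable
    _ ≤ 16 * K * ∫⁻ x in I.toSet, g x * (2 * (g x * (W x)⁻¹)) := by
        gcongr with x
        exact tsum_zpow_le _
    _ = _ := by
        have : ∀ x, g x * (2 * (g x * (W x)⁻¹)) = 2 * (g x ^ 2 * (W x)⁻¹) := fun x => by ring
        simp only [this]
        rw [lintegral_const_mul _ (by fun_prop)]
        ring

/-! ### The chain `I_m` and the values of the weight on its pieces. -/

theorem Dyadic.nest (I : HOInterval) (m : ℕ) : I.Dyadic (I.nest m) := by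
  induction m with
  | zero => exact .self
  | succ m ih => exact .plus _ (.plus _ ih)

theorem nest_subset_plus_plus (I : HOInterval) {m j : ℕ} (h : m < j) :
    (I.nest j).toSet ⊆ (I.nest m).plus.plus.toSet := by
  induction j, h using Nat.le_induction with
  | base => exact Subset.rfl
  | succ j _ ih => exact ((plus_subset _).trans (plus_subset _)).trans ih

theorem chi_of_mem {I : HOInterval} {x : ℝ} (h : x ∈ I.toSet) : I.chi x = 1 := by simp [chi, h]

theorem chi_of_notMem {I : HOInterval} {x : ℝ} (h : x ∉ I.toSet) : I.chi x = 0 := by simp [chi, h]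

theorem measurable_chi (I : HOInterval) : Measurable I.chi :=
  measurable_const.indicator I.measurableSet_toSet

/-- All later members of the chain lie in `I_m^{++}`, which misses `I_m^-` and `I_m^{+-}`. Hence at
most one summand in the definition of the weight is nonzero at a given point. -/
theorem eq_of_mem_nest_minus_union {I : HOInterval} {m j : ℕ} {x : ℝ}
    (hm : x ∈ (I.nest m).minus.toSet ∪ (I.nest m).plus.minus.toSet)
    (hj : x ∈ (I.nest j).minus.toSet ∪ (I.nest j).plus.minus.toSet) : m = j := by
  have key : ∀ {m j : ℕ}, x ∈ (I.nest m).minus.toSet ∪ (I.nest m).plus.minus.toSet →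
      x ∈ (I.nest j).toSet → ¬ m < j := fun {m j} hm hj hlt => by
    have h := I.nest_subset_plus_plus hlt hj
    rcases hm with hm | hm
    · exact Set.disjoint_left.1 (disjoint_minus_plus _) hm (plus_subset _ h)
    · exact Set.disjoint_left.1 (disjoint_minus_plus _) hm h
  have sub : ∀ {m : ℕ}, x ∈ (I.nest m).minus.toSet ∪ (I.nest m).plus.minus.toSet →
      x ∈ (I.nest m).toSet := fun {m} hm => by
    rcases hm with hm | hm
    · exact minus_subset _ hm
    · exact plus_subset _ (minus_subset _ hm)
  exact le_antisymm (not_lt.1 (key hj (sub hm))) (not_lt.1 (key hm (sub hj)))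

theorem notMem_minus_of_mem_plus {I : HOInterval} {x : ℝ} (h : x ∈ I.plus.toSet) :
    x ∉ I.minus.toSet := Set.disjoint_right.1 (disjoint_minus_plus _) h

theorem notMem_plus_of_mem_minus {I : HOInterval} {x : ℝ} (h : x ∈ I.minus.toSet) :
    x ∉ I.plus.toSet := Set.disjoint_left.1 (disjoint_minus_plus _) h

theorem notMem_nest_plus {I : HOInterval} {m K : ℕ} (hmK : m ≤ K) {x : ℝ}
    (h : x ∈ (I.nest m).minus.toSet) : x ∉ (I.nest K).plus.toSet := by
  rcases hmK.eq_or_lt with rfl | hlt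
  · exact notMem_plus_of_mem_minus h
  · exact fun hx => notMem_plus_of_mem_minus h
      (plus_subset _ (nest_subset_plus_plus I hlt (plus_subset _ hx)))

theorem notMem_nest_plus' {I : HOInterval} {m K : ℕ} (hmK : m < K) {x : ℝ}
    (h : x ∈ (I.nest m).plus.minus.toSet) : x ∉ (I.nest K).toSet :=
  fun hx => notMem_plus_of_mem_minus h (nest_subset_plus_plus I hmK hx)

end HOInterval

namespace DyadicWeight

open HOInterval

theorem measurable_w (k n : ℕ) (ω : ℝ) (I : HOInterval) : Measurable (w k n ω I) := by
  induction n generalizing ω I with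
  | zero =>
    have := measurable_chi
    unfold w
    fun_prop
  | succ n ih =>
    have := measurable_chi
    unfold w
    fun_prop

theorem w_eq_zero {k n : ℕ} {ω : ℝ} {I : HOInterval} {x : ℝ} (hx : x ∉ I.toSet) :
    w k n ω I x = 0 := by
  have hsub : ∀ {J}, I.Dyadic J → x ∉ J.toSet := fun hJ h => hx (hJ.subset h)
  induction n generalizing ω I with
  | zero =>
    simp [w, chi_of_notMem (hsub I.dyadic_minus), chi_of_notMem (hsub I.dyadic_plus)]
  | succ n ih =>
    have hN := Dyadic.nest I
    have h1 : ∀ m, w k n (3 * ω) (I.nest m).plus.minus x = 0 := fun m =>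
      ih (hsub (.minus _ (.plus _ (hN m)))) fun hJ =>
        hsub ((Dyadic.minus _ (.plus _ (hN m))).trans hJ)
    have h2 : ∀ m, (I.nest m).minus.chi x = 0 := fun m => chi_of_notMem (hsub (.minus _ (hN m)))
    have h3 : ∀ m, (I.nest m).plus.chi x = 0 := fun m => chi_of_notMem (hsub (.plus _ (hN m)))
    simp [w, h1, h2, h3]

theorem w_succ_minus {k n : ℕ} {ω : ℝ} {I : HOInterval} {m : ℕ} (hm : m ≤ k - 1) {x : ℝ}
    (hx : x ∈ (I.nest m).minus.toSet) : w k (n + 1) ω I x = ω / pp k := by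
  have h1 : ∀ j, w k n (3 * ω) (I.nest j).plus.minus x = 0 := fun j => w_eq_zero fun hj => by
    obtain rfl := eq_of_mem_nest_minus_union (Or.inl hx) (Or.inr hj)
    exact notMem_plus_of_mem_minus hx (minus_subset _ hj)
  have h2 : ∀ j, j ≠ m → (I.nest j).minus.chi x = 0 := fun j hj => chi_of_notMem fun h =>
    hj (eq_of_mem_nest_minus_union (Or.inl h) (Or.inl hx))
  have h3 : (I.nest (k - 1)).plus.chi x = 0 := chi_of_notMem (notMem_nest_plus hm hx)
  simp only [w, h1, h3, Finset.sum_const_zero]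
  rcases hm.eq_or_lt with rfl | hlt
  · rw [Finset.sum_eq_zero fun j hj => h2 j (Finset.mem_range.1 hj).ne, chi_of_mem hx]
    simp
  · rw [Finset.sum_eq_single_of_mem m (Finset.mem_range.2 hlt) fun j _ hj => h2 j hj,
      h2 _ hlt.ne', chi_of_mem hx]
    simp

theorem w_succ_plus_minus {k n : ℕ} {ω : ℝ} {I : HOInterval} {m : ℕ} (hm : m < k - 1) {x : ℝ}
    (hx : x ∈ (I.nest m).plus.minus.toSet) :
    w k (n + 1) ω I x = w k n (3 * ω) (I.nest m).plus.minus x := by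
  have h1 : ∀ j, j ≠ m → w k n (3 * ω) (I.nest j).plus.minus x = 0 := fun j hj =>
    w_eq_zero fun h => hj (eq_of_mem_nest_minus_union (Or.inr h) (Or.inr hx))
  have h2 : ∀ j, (I.nest j).minus.chi x = 0 := fun j => chi_of_notMem fun h => by
    obtain rfl := eq_of_mem_nest_minus_union (Or.inr hx) (Or.inl h)
    exact notMem_plus_of_mem_minus h (minus_subset _ hx)
  have h3 : (I.nest (k - 1)).plus.chi x = 0 := chi_of_notMem fun h =>
    notMem_nest_plus' hm hx (plus_subset _ h)
  simp only [w, h2, h3]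
  rw [Finset.sum_eq_single_of_mem m (Finset.mem_range.2 hm) fun j _ hj => h1 j hj]
  simp

theorem w_succ_plus {k n : ℕ} {ω : ℝ} {I : HOInterval} {x : ℝ}
    (hx : x ∈ (I.nest (k - 1)).plus.toSet) : w k (n + 1) ω I x = ω / pp k * tau k := by
  have h1 : ∀ j ∈ Finset.range (k - 1), w k n (3 * ω) (I.nest j).plus.minus x = 0 := fun j hj =>
    w_eq_zero fun h => notMem_nest_plus' (Finset.mem_range.1 hj) h (plus_subset _ hx)
  have h2 : ∀ j, j ≤ k - 1 → (I.nest j).minus.chi x = 0 := fun j hj => chi_of_notMem fun h =>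
    notMem_nest_plus hj h hx
  simp only [w]
  rw [Finset.sum_eq_zero h1, Finset.sum_eq_zero fun j hj => h2 j (Finset.mem_range.1 hj).le,
    h2 _ le_rfl, chi_of_mem hx]
  simp

theorem w_zero_minus {k : ℕ} {ω : ℝ} {I : HOInterval} {x : ℝ} (hx : x ∈ I.minus.toSet) :
    w k 0 ω I x = ω / √(pp k) * (√(pp k) - √(pp k - 1)) := by
  simp [w, chi_of_mem hx, chi_of_notMem (notMem_plus_of_mem_minus hx)]

theorem w_zero_plus {k : ℕ} {ω : ℝ} {I : HOInterval} {x : ℝ} (hx : x ∈ I.plus.toSet) :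
    w k 0 ω I x = ω / √(pp k) * (√(pp k) + √(pp k - 1)) := by
  simp [w, chi_of_mem hx, chi_of_notMem (notMem_minus_of_mem_plus hx)]

/-! ### The parameters -/

theorem eps_pos (k : ℕ) : 0 < eps k := by unfold eps; positivity

theorem tau_pos (k : ℕ) : 0 < tau k := by
  have := eps_pos k
  unfold tau
  positivity

theorem tau_eq (k : ℕ) : tau k = 9 / (4 ^ k + 5) := by
  unfold tau eps
  field_simp

theorem pp_eq (k : ℕ) : pp k = (4 ^ k - 1) / 6 + tau k / 2 := by
  have := eps_pos k
  have e : (4 : ℝ) ^ k = (eps k)⁻¹ := by simp [eps]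
  rw [e]
  unfold pp
  field_simp
  ring

theorem sixteen_le {k : ℕ} (hk : 2 ≤ k) : (16 : ℝ) ≤ 4 ^ k :=
  calc (16 : ℝ) = 4 ^ 2 := by norm_num
    _ ≤ 4 ^ k := pow_le_pow_right₀ (by norm_num) hk

theorem tau_le {k : ℕ} (hk : 2 ≤ k) : tau k ≤ 9 / 21 := by
  rw [tau_eq]
  have := sixteen_le hk
  gcongr
  linarith

theorem le_pp {k : ℕ} (hk : 2 ≤ k) : (4 : ℝ) ^ k / 8 ≤ pp k := by
  have := sixteen_le hk
  have := tau_pos k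
  rw [pp_eq]
  linarith

theorem pp_le {k : ℕ} (hk : 2 ≤ k) : pp k ≤ (4 : ℝ) ^ k / 5 := by
  have := sixteen_le hk
  have := tau_le hk
  rw [pp_eq]
  linarith

theorem two_le_pp {k : ℕ} (hk : 2 ≤ k) : 2 ≤ pp k := by
  have := sixteen_le hk
  have := le_pp hk
  linarith

end DyadicWeight

/-! ### Averages and truncated testing integrals. -/

namespace HOInterval

variable {W : ℝ → ℝ≥0∞} {J : HOInterval}

theorem avg_le {c : ℝ} (hc : 0 ≤ c)
    (h : ∫⁻ x in J.toSet, W x ≤ ENNReal.ofReal (c * J.len)) : avg W J ≤ ENNReal.ofReal c := by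
  rw [avg_eq]
  refine ENNReal.div_le_of_le_mul (h.trans_eq ?_)
  rw [ENNReal.ofReal_mul hc]

theorem le_avg {c : ℝ} (hJ : 0 < J.len) (hc : 0 ≤ c)
    (h : ENNReal.ofReal (c * J.len) ≤ ∫⁻ x in J.toSet, W x) : ENNReal.ofReal c ≤ avg W J := by
  rw [avg_eq, ENNReal.le_div_iff_mul_le (Or.inl (by simpa using hJ)) (Or.inl (by simp)),
    ← ENNReal.ofReal_mul hc]
  exact h

theorem avg_le_of_forall_le {c : ℝ≥0∞} (h : ∀ x ∈ J.toSet, W x ≤ c) : avg W J ≤ c := by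
  rw [avg_eq]
  refine ENNReal.div_le_of_le_mul ((setLIntegral_mono' J.measurableSet_toSet h).trans_eq ?_)
  rw [setLIntegral_const, volume_toSet]

theorem dyadicSup_avg_le_of_forall_le {c : ℝ≥0∞} (h : ∀ x ∈ J.toSet, W x ≤ c) (x : ℝ) :
    dyadicSup (avg W) J x ≤ c :=
  dyadicSup_le fun _ hL _ => avg_le_of_forall_le fun y hy => h y (hL.subset hy)

section Const

variable {c : ℝ}

theorem lintegral_of_const (hc : 0 ≤ c) (h : ∀ x ∈ J.toSet, W x = ENNReal.ofReal c) :
    ∫⁻ x in J.toSet, W x = ENNReal.ofReal (c * J.len) := by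
  rw [setLIntegral_congr_fun J.measurableSet_toSet h, setLIntegral_const, volume_toSet,
    ENNReal.ofReal_mul hc]

theorem lintegral_inv_of_const (hc : 0 < c) (h : ∀ x ∈ J.toSet, W x = ENNReal.ofReal c) :
    ∫⁻ x in J.toSet, (W x)⁻¹ = ENNReal.ofReal (c⁻¹ * J.len) :=
  lintegral_of_const (by positivity) fun x hx => by rw [h x hx, ENNReal.ofReal_inv_of_pos hc]

theorem lintegral_dyadicSup_of_const (hc : 0 < c) (h : ∀ x ∈ J.toSet, W x = ENNReal.ofReal c) :
    ∫⁻ x in J.toSet, dyadicSup (avg W) J x ^ 2 * (W x)⁻¹ ≤ ∫⁻ x in J.toSet, W x := by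
  refine setLIntegral_mono' J.measurableSet_toSet fun x hx => ?_
  calc _ ≤ ENNReal.ofReal c ^ 2 * (W x)⁻¹ := by
        gcongr
        exact dyadicSup_avg_le_of_forall_le (fun y hy => (h y hy).le) x
    _ = W x := by
        rw [h x hx, sq, mul_assoc, ENNReal.mul_inv_cancel (by simpa using hc) (by simp), mul_one]

end Const

/-- The testing integral over `J` of the maximal function truncated from below at `L`. -/
noncomputable def maxTest (W : ℝ → ℝ≥0∞) (L : ℝ≥0∞) (J : HOInterval) : ℝ≥0∞ :=
  ∫⁻ x in J.toSet, (L ⊔ dyadicSup (avg W) J x) ^ 2 * (W x)⁻¹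

/-- The truncation level already dominates the average over `J`, the only one not seen from the
halves. -/
theorem maxTest_le_halves {L : ℝ≥0∞} (h : avg W J ≤ L) :
    maxTest W L J ≤ maxTest W L J.minus + maxTest W L J.plus := by
  rw [maxTest, lintegral_halves]
  refine add_le_add (setLIntegral_mono' J.minus.measurableSet_toSet fun x hx => ?_)
    (setLIntegral_mono' J.plus.measurableSet_toSet fun x hx => ?_)
  · gcongr ?_ ^ 2 * _
    exact sup_le le_sup_left ((dyadicSup_minus hx).trans (sup_le_sup_right h _))
  · gcongr ?_ ^ 2 * _
    exact sup_le le_sup_left ((dyadicSup_plus hx).trans (sup_le_sup_right h _))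

theorem maxTest_le_of_forall_le {L : ℝ} (hL : 0 ≤ L) {v : ℝ}
    (h : ∀ x ∈ J.toSet, W x ≤ ENNReal.ofReal L)
    (hv : ∫⁻ x in J.toSet, (W x)⁻¹ ≤ ENNReal.ofReal v) :
    maxTest W (ENNReal.ofReal L) J ≤ ENNReal.ofReal (L ^ 2 * v) := by
  calc maxTest W (ENNReal.ofReal L) J
      ≤ ∫⁻ x in J.toSet, ENNReal.ofReal L ^ 2 * (W x)⁻¹ := by
        refine lintegral_mono fun x => ?_
        dsimp only
        gcongr
        exact sup_le le_rfl (dyadicSup_avg_le_of_forall_le h x)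
    _ = ENNReal.ofReal L ^ 2 * ∫⁻ x in J.toSet, (W x)⁻¹ :=
        lintegral_const_mul' _ _ (by simp)
    _ ≤ _ := by
        rw [ENNReal.ofReal_mul (by positivity), ENNReal.ofReal_pow hL]
        gcongr

theorem maxTest_eq {L : ℝ≥0∞} (h : L ≤ avg W J) :
    maxTest W L J = ∫⁻ x in J.toSet, dyadicSup (avg W) J x ^ 2 * (W x)⁻¹ := by
  refine setLIntegral_congr_fun J.measurableSet_toSet fun x hx => ?_
  rw [sup_eq_right.2 (h.trans (le_dyadicSup _ .self hx))]

theorem lintegral_dyadicSup_le_maxTest (L : ℝ≥0∞) {I : HOInterval} (h : I.Dyadic J) :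
    ∫⁻ x in J.toSet, dyadicSup (avg W) J x ^ 2 * (W x)⁻¹ ≤ maxTest W L I := by
  refine (lintegral_mono fun x => ?_).trans (lintegral_mono_set h.subset)
  dsimp only
  gcongr
  exact (dyadicSup_of_dyadic_le _ h x).trans le_sup_right

end HOInterval

/-! ### Averages of the weight and the testing condition. -/

namespace DyadicWeight

open HOInterval

/-- The function `W` coincides on `I` with the weight `w_n(ω, σ, I)`. -/
structure IsWeight (k n : ℕ) (ω : ℝ) (I : HOInterval) (W : ℝ → ℝ≥0∞) : Prop where
  two_le : 2 ≤ k
  pos : 0 < ω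
  len_pos : 0 < I.len
  eq : ∀ x ∈ I.toSet, W x = ENNReal.ofReal (w k n ω I x)

namespace IsWeight

variable {k n : ℕ} {ω : ℝ} {I : HOInterval} {W : ℝ → ℝ≥0∞} {m : ℕ}

theorem len_nest_pos (h : IsWeight k n ω I W) (m : ℕ) : 0 < (I.nest m).len :=
  (Dyadic.nest I m).len_pos h.len_pos

theorem nest_minus (h : IsWeight k (n + 1) ω I W) (hm : m ≤ k - 1) :
    ∀ x ∈ (I.nest m).minus.toSet, W x = ENNReal.ofReal (ω / pp k) := fun x hx => by
  rw [h.eq x ((Dyadic.minus _ (Dyadic.nest I m)).subset hx), w_succ_minus hm hx]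

theorem nest_plus (h : IsWeight k (n + 1) ω I W) :
    ∀ x ∈ (I.nest (k - 1)).plus.toSet, W x = ENNReal.ofReal (ω / pp k * tau k) := fun x hx => by
  rw [h.eq x ((Dyadic.plus _ (Dyadic.nest I _)).subset hx), w_succ_plus hx]

theorem nest_plus_minus (h : IsWeight k (n + 1) ω I W) (hm : m < k - 1) :
    IsWeight k n (3 * ω) (I.nest m).plus.minus W where
  two_le := h.two_le
  pos := by have := h.pos; positivity
  len_pos := (Dyadic.minus _ (.plus _ (Dyadic.nest I m))).len_pos h.len_pos
  eq := fun x hx => by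
    rw [h.eq x ((Dyadic.minus _ (.plus _ (Dyadic.nest I m))).subset hx), w_succ_plus_minus hm hx]

theorem pp_pos (h : IsWeight k n ω I W) : 0 < pp k := by linarith [two_le_pp h.two_le]

theorem four_pow_pred (h : IsWeight k n ω I W) : (4 : ℝ) ^ (k - 1) = 4 ^ k / 4 := by
  have := h.two_le
  obtain ⟨j, rfl⟩ : ∃ j, k = j + 1 := ⟨k - 1, by omega⟩
  simp [pow_succ]

theorem four_pow_le (h : IsWeight k n ω I W) (hm : m ≤ k - 1) : (4 : ℝ) ^ m ≤ 4 ^ k / 4 :=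
  h.four_pow_pred ▸ pow_le_pow_right₀ (by norm_num) hm

theorem four_mul_four_pow_le (h : IsWeight k n ω I W) (hm : m < k - 1) :
    4 * (4 : ℝ) ^ m ≤ 4 ^ k / 4 := by
  have := h.four_pow_le (m := m + 1) hm
  rwa [pow_succ, mul_comm] at this

/-- Up to the factor `ω / p` this is the average over `I_m`; positivity is needed to add integrals
inside `ENNReal.ofReal`. -/
theorem nest_coeff_pos (h : IsWeight k n ω I W) (hm : m ≤ k - 1) :
    0 < pp k - 2 / 3 * (4 ^ m - 1) := by
  have h1 := h.four_pow_le hm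
  have h2 := tau_pos k
  rw [pp_eq]
  linarith

/-- The integral of the weight over `I_m`, provided the weights of the generation below have the
right averages. -/
theorem lintegral_nest_of (h : IsWeight k (n + 1) ω I W)
    (ih : ∀ m < k - 1, ∫⁻ x in (I.nest m).plus.minus.toSet, W x =
      ENNReal.ofReal (3 * ω * (I.nest m).plus.minus.len)) (hm : m ≤ k - 1) :
    ∫⁻ x in (I.nest m).toSet, W x =
      ENNReal.ofReal (ω / pp k * (pp k - 2 / 3 * (4 ^ m - 1)) * (I.nest m).len) := by
  have hp := h.pp_pos
  have hω := h.pos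
  have ht := tau_pos k
  have hl := h.len_nest_pos
  obtain ⟨j, hj⟩ := Nat.exists_eq_add_of_le hm
  induction j generalizing m with
  | zero =>
    obtain rfl : m = k - 1 := by omega
    rw [lintegral_halves, lintegral_of_const (by positivity) (h.nest_minus le_rfl),
      lintegral_of_const (by positivity) h.nest_plus, len_minus, len_plus,
      ← ENNReal.ofReal_add (by have := hl (k - 1); positivity) (by have := hl (k - 1); positivity),
      h.four_pow_pred]
    congr 1
    -- The value of `p` enters only here, to match the average `ω(1 + τ)/(2p)` over `I_{k-1}`.
    have := pp_eq k
    linear_combination (-(ω / pp k * (I.nest (k - 1)).len)) * this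
  | succ j ihj =>
    have h1 := ihj (m := m + 1) (by omega) (by omega)
    have hm' : m < k - 1 := by omega
    have hc := h.nest_coeff_pos (m := m + 1) (by omega)
    have e : (I.nest (m + 1)) = (I.nest m).plus.plus := rfl
    have hlm := hl m
    rw [e] at h1
    rw [lintegral_halves, lintegral_halves (I.nest m).plus, h1, ih m hm',
      lintegral_of_const (by positivity) (h.nest_minus hm)]
    simp only [len_minus, len_plus]
    rw [← ENNReal.ofReal_add (by positivity) (by positivity),
      ← ENNReal.ofReal_add (by positivity) (by positivity)]
    congr 1
    rw [pow_succ]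
    field_simp
    ring

/-- In units of `p/ω` the averages satisfy `a_m = 1/2 + 1/12 + a_{m+1}/4`, with fixed point `7/9`,
and the deviation from it grows by the factor 4 at each step. The choice of `τ` gives the right
value at `m = k - 1`, and hence `a_0 = 1`. -/
theorem lintegral_inv_nest_of (h : IsWeight k (n + 1) ω I W)
    (ih : ∀ m < k - 1, ∫⁻ x in (I.nest m).plus.minus.toSet, (W x)⁻¹ =
      ENNReal.ofReal (pp k / (3 * ω) * (I.nest m).plus.minus.len)) (hm : m ≤ k - 1) :
    ∫⁻ x in (I.nest m).toSet, (W x)⁻¹ =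
      ENNReal.ofReal (pp k / ω * ((7 + 2 * 4 ^ m) / 9) * (I.nest m).len) := by
  have hp := h.pp_pos
  have hω := h.pos
  have ht := tau_pos k
  have hl := h.len_nest_pos
  obtain ⟨j, hj⟩ := Nat.exists_eq_add_of_le hm
  induction j generalizing m with
  | zero =>
    obtain rfl : m = k - 1 := by omega
    have hlk := hl (k - 1)
    rw [lintegral_halves, lintegral_inv_of_const (by positivity) (h.nest_minus le_rfl),
      lintegral_inv_of_const (by positivity) h.nest_plus, len_minus, len_plus,
      ← ENNReal.ofReal_add (by positivity) (by positivity),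
      h.four_pow_pred]
    congr 1
    rw [tau_eq]
    field_simp
    ring
  | succ j ihj =>
    have h1 := ihj (m := m + 1) (by omega) (by omega)
    have hm' : m < k - 1 := by omega
    have e : (I.nest (m + 1)) = (I.nest m).plus.plus := rfl
    have hlm := hl m
    rw [e] at h1
    rw [lintegral_halves, lintegral_halves (I.nest m).plus, h1, ih m hm',
      lintegral_inv_of_const (by positivity) (h.nest_minus hm)]
    simp only [len_minus, len_plus]
    rw [← ENNReal.ofReal_add (by positivity) (by positivity),
      ← ENNReal.ofReal_add (by positivity) (by positivity)]
    congr 1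
    rw [pow_succ]
    field_simp
    ring

theorem base_coeff (h : IsWeight k n ω I W) :
    0 < ω / √(pp k) * (√(pp k) - √(pp k - 1)) ∧ 0 < ω / √(pp k) * (√(pp k) + √(pp k - 1)) ∧
    √(pp k) ^ 2 = pp k ∧ √(pp k - 1) ^ 2 = pp k - 1 := by
  have hp := two_le_pp h.two_le
  have hω := h.pos
  have h1 : 0 < √(pp k) := Real.sqrt_pos.2 (by linarith)
  have h2 : √(pp k - 1) < √(pp k) := Real.sqrt_lt_sqrt (by linarith) (by linarith)
  refine ⟨mul_pos (by positivity) (by linarith), by positivity, ?_, ?_⟩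
  · exact Real.sq_sqrt (by linarith)
  · exact Real.sq_sqrt (by linarith)

theorem minus_zero (h : IsWeight k 0 ω I W) :
    ∀ x ∈ I.minus.toSet, W x = ENNReal.ofReal (ω / √(pp k) * (√(pp k) - √(pp k - 1))) :=
  fun x hx => by rw [h.eq x (minus_subset _ hx), w_zero_minus hx]

theorem plus_zero (h : IsWeight k 0 ω I W) :
    ∀ x ∈ I.plus.toSet, W x = ENNReal.ofReal (ω / √(pp k) * (√(pp k) + √(pp k - 1))) :=
  fun x hx => by rw [h.eq x (plus_subset _ hx), w_zero_plus hx]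

/-- The averages of `w_n(ω, σ, I)` and of its inverse over `I` are `ω` and `σ = p / ω`. -/
theorem lintegral_eq_and (h : IsWeight k n ω I W) :
    ∫⁻ x in I.toSet, W x = ENNReal.ofReal (ω * I.len) ∧
      ∫⁻ x in I.toSet, (W x)⁻¹ = ENNReal.ofReal (pp k / ω * I.len) := by
  have hp := h.pp_pos
  have hω := h.pos
  have hl := h.len_pos
  induction n generalizing ω I with
  | zero =>
    obtain ⟨h1, h2, h3, h4⟩ := h.base_coeff
    have hsp : 0 < √(pp k) := Real.sqrt_pos.2 hp
    constructor
    · rw [lintegral_halves, lintegral_of_const h1.le h.minus_zero,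
        lintegral_of_const h2.le h.plus_zero, len_minus, len_plus,
        ← ENNReal.ofReal_add (by positivity) (by positivity)]
      congr 1
      field_simp
      ring
    · rw [lintegral_halves, lintegral_inv_of_const h1 h.minus_zero,
        lintegral_inv_of_const h2 h.plus_zero, len_minus, len_plus,
        ← ENNReal.ofReal_add (by positivity) (by positivity)]
      congr 1
      have h5 : √(pp k) - √(pp k - 1) ≠ 0 := fun h0 => by simp [h0] at h1
      have h6 : √(pp k) + √(pp k - 1) ≠ 0 := fun h0 => by simp [h0] at h2
      -- The product of the two factors is `p - (p - 1) = 1`, so inversion interchanges them.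
      have h7 : (√(pp k) - √(pp k - 1))⁻¹ = √(pp k) + √(pp k - 1) := by
        rw [inv_eq_iff_eq_inv, eq_comm]
        refine inv_eq_of_mul_eq_one_right ?_
        linear_combination h3 - h4
      have h8 : (√(pp k) + √(pp k - 1))⁻¹ = √(pp k) - √(pp k - 1) := by
        rw [← h7, inv_inv]
      rw [mul_inv, mul_inv, h7, h8, inv_div]
      field_simp
      linear_combination 2 * h3
  | succ n ih =>
    constructor
    · have := h.lintegral_nest_of (m := 0) (fun m hm => by
        have hI := h.nest_plus_minus hm
        exact (ih hI hI.pos hI.len_pos).1) (Nat.zero_le _)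
      rw [show I.nest 0 = I from rfl] at this
      convert this using 2
      field_simp
      ring
    · have := h.lintegral_inv_nest_of (m := 0) (fun m hm => by
        have hI := h.nest_plus_minus hm
        exact (ih hI hI.pos hI.len_pos).2) (Nat.zero_le _)
      rw [show I.nest 0 = I from rfl] at this
      convert this using 2
      norm_num

theorem lintegral_nest (h : IsWeight k (n + 1) ω I W) (hm : m ≤ k - 1) :
    ∫⁻ x in (I.nest m).toSet, W x =
      ENNReal.ofReal (ω / pp k * (pp k - 2 / 3 * (4 ^ m - 1)) * (I.nest m).len) :=
  h.lintegral_nest_of (fun _ hm => (h.nest_plus_minus hm).lintegral_eq_and.1) hm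

theorem lintegral_inv_nest (h : IsWeight k (n + 1) ω I W) (hm : m ≤ k - 1) :
    ∫⁻ x in (I.nest m).toSet, (W x)⁻¹ =
      ENNReal.ofReal (pp k / ω * ((7 + 2 * 4 ^ m) / 9) * (I.nest m).len) :=
  h.lintegral_inv_nest_of (fun _ hm => (h.nest_plus_minus hm).lintegral_eq_and.2) hm

variable {k n : ℕ} {ω : ℝ} {I : HOInterval} {W : ℝ → ℝ≥0∞} {m : ℕ}

theorem le_of_mem_last (h : IsWeight k (n + 1) ω I W) :
    ∀ x ∈ (I.nest (k - 1)).toSet, W x ≤ ENNReal.ofReal (ω / pp k) := fun x hx => by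
  have := h.pos
  have := h.pp_pos
  rw [← minus_union_plus] at hx
  rcases hx with hx | hx
  · exact (h.nest_minus le_rfl x hx).le
  · rw [h.nest_plus x hx]
    refine ENNReal.ofReal_le_ofReal (mul_le_of_le_one_right (by positivity) ?_)
    linarith [tau_le h.two_le]

theorem lintegral_nest_le (h : IsWeight k (n + 1) ω I W) (hm : m ≤ k - 1) :
    ∫⁻ x in (I.nest m).toSet, W x ≤ ENNReal.ofReal (ω * (I.nest m).len) := by
  have hp := h.pp_pos
  have hω := h.pos
  have hl := h.len_nest_pos m
  rw [h.lintegral_nest hm]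
  refine ENNReal.ofReal_le_ofReal (mul_le_mul_of_nonneg_right ?_ hl.le)
  have h4 : (1 : ℝ) ≤ 4 ^ m := one_le_pow₀ (by norm_num)
  calc ω / pp k * (pp k - 2 / 3 * (4 ^ m - 1)) ≤ ω / pp k * pp k := by
        gcongr
        linarith
    _ = ω := div_mul_cancel₀ _ hp.ne'

theorem maxTest_nest_le (h : IsWeight k (n + 1) ω I W)
    (ih : ∀ m < k - 1, ∫⁻ x in (I.nest m).plus.minus.toSet,
      dyadicSup (avg W) (I.nest m).plus.minus x ^ 2 * (W x)⁻¹ ≤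
        ENNReal.ofReal (pp k * 4 ^ k * (3 * ω) * (I.nest m).plus.minus.len)) (hm : m ≤ k - 1) :
    maxTest W (ENNReal.ofReal (2 * ω)) (I.nest m) ≤
      ENNReal.ofReal (4 * ω * pp k * ((7 + 2 * 4 ^ m) / 9) * (I.nest m).len +
        pp k * ω * (4 ^ k - 4 * 4 ^ m) * (I.nest m).len) := by
  have hp := h.pp_pos
  have h2p := two_le_pp h.two_le
  have hω := h.pos
  have hl := h.len_nest_pos
  have hle : ω / pp k ≤ 2 * ω := by
    rw [div_le_iff₀ hp]
    nlinarith
  obtain ⟨j, hj⟩ := Nat.exists_eq_add_of_le hm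
  induction j generalizing m with
  | zero =>
    obtain rfl : m = k - 1 := by omega
    refine (maxTest_le_of_forall_le (by positivity)
      (fun x hx => (h.le_of_mem_last x hx).trans (ENNReal.ofReal_le_ofReal hle))
      (h.lintegral_inv_nest le_rfl).le).trans (le_of_eq ?_)
    congr 1
    rw [h.four_pow_pred]
    field_simp
    ring
  | succ j ihj =>
    have hm' : m < k - 1 := by omega
    have hlm := hl m
    have hI' := h.nest_plus_minus hm'
    have h1 : maxTest W _ (I.nest m).plus.plus ≤ _ := ihj (m := m + 1) (by omega) (by omega)
    have e : (I.nest (m + 1)).len = (I.nest m).len / 4 := by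
      show (I.nest m).len / 2 / 2 = _
      ring
    have ha : avg W (I.nest m) ≤ ENNReal.ofReal (2 * ω) :=
      avg_le (by positivity) ((h.lintegral_nest_le hm).trans
        (ENNReal.ofReal_le_ofReal (by nlinarith)))
    have hb : avg W (I.nest m).plus ≤ ENNReal.ofReal (2 * ω) :=
      avg_le (by positivity) ((lintegral_mono_set (plus_subset _)).trans
        ((h.lintegral_nest_le hm).trans_eq (by rw [len_plus]; congr 1; ring)))
    have hc : maxTest W (ENNReal.ofReal (2 * ω)) (I.nest m).minus ≤
        ENNReal.ofReal ((2 * ω) ^ 2 * ((ω / pp k)⁻¹ * (I.nest m).minus.len)) :=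
      maxTest_le_of_forall_le (by positivity)
        (fun x hx => (h.nest_minus hm x hx).le.trans (ENNReal.ofReal_le_ofReal hle))
        (lintegral_inv_of_const (by positivity) (h.nest_minus hm)).le
    have hd : maxTest W (ENNReal.ofReal (2 * ω)) (I.nest m).plus.minus ≤
        ENNReal.ofReal (pp k * 4 ^ k * (3 * ω) * (I.nest m).plus.minus.len) := by
      -- The average over `I_m^{+-}` is `3ω`, above the truncation level `2ω`, so the truncation is
      -- invisible there.
      rw [maxTest_eq]
      · exact ih m hm'
      · refine le_avg hI'.len_pos (by positivity) ?_
        rw [hI'.lintegral_eq_and.1]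
        refine ENNReal.ofReal_le_ofReal (mul_le_mul_of_nonneg_right ?_ hI'.len_pos.le)
        linarith
    have h4 := h.four_mul_four_pow_le hm'
    have h4' : (0 : ℝ) < 4 ^ m := by positivity
    have hnn : 0 ≤ (4 : ℝ) ^ k - 4 * 4 ^ (m + 1) := by rw [pow_succ]; linarith
    refine (maxTest_le_halves ha).trans ((add_le_add hc ((maxTest_le_halves hb).trans
      (add_le_add hd h1))).trans ?_)
    simp only [len_minus, len_plus, e]
    have hx : 0 ≤ pp k * ω * (4 ^ k - 4 * 4 ^ (m + 1)) * ((I.nest m).len / 4) := by positivity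
    rw [← ENNReal.ofReal_add (by positivity) (by positivity),
      ← ENNReal.ofReal_add (by positivity) (by positivity)]
    refine ENNReal.ofReal_le_ofReal ?_
    have hy : 0 ≤ ω * pp k * (I.nest m).len := by positivity
    rw [← sub_nonneg]
    -- The surplus `ω p |I_m| / 3` is `(2ω)² w⁻¹(I_m^{+-})`: the first term of the bound counts all
    -- of `I_m`, including the copy.
    refine le_of_le_of_eq (mul_nonneg hy (by norm_num : (0 : ℝ) ≤ 1 / 3)) ?_
    rw [pow_succ]
    field_simp
    ring

/-- The testing condition on the intervals that carry a weight `w_n(ω, σ, I)`. -/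
theorem lintegral_dyadicSup_le (h : IsWeight k n ω I W) :
    ∫⁻ x in I.toSet, dyadicSup (avg W) I x ^ 2 * (W x)⁻¹ ≤
      ENNReal.ofReal (pp k * 4 ^ k * ω * I.len) := by
  have hp := h.pp_pos
  have hω := h.pos
  have hl := h.len_pos
  have h16 := sixteen_le h.two_le
  induction n generalizing ω I with
  | zero =>
    obtain ⟨h1, h2, h3, h4⟩ := h.base_coeff
    have h5 := two_le_pp h.two_le
    have hs : 0 < √(pp k) := Real.sqrt_pos.2 hp
    have h6 : √(pp k - 1) ≤ √(pp k) := Real.sqrt_le_sqrt (by linarith)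
    have h7 := Real.sqrt_nonneg (pp k - 1)
    have hle : ∀ x ∈ I.toSet, W x ≤ ENNReal.ofReal (2 * ω) := fun x hx => by
      rw [← minus_union_plus] at hx
      have e : 2 * ω = ω / √(pp k) * (√(pp k) + √(pp k)) := by field_simp; ring
      rw [e]
      rcases hx with hx | hx
      · rw [h.minus_zero x hx]
        gcongr
        linarith
      · rw [h.plus_zero x hx]
        gcongr
    refine (lintegral_dyadicSup_le_maxTest _ .self).trans
      ((maxTest_le_of_forall_le (by positivity) hle h.lintegral_eq_and.2.le).trans ?_)
    refine ENNReal.ofReal_le_ofReal ?_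
    -- The maximal function is at most `2ω` here, and `4 ≤ 4^k` closes the estimate.
    have e : (2 * ω) ^ 2 * (pp k / ω * I.len) = 4 * (pp k * ω * I.len) := by field_simp; ring
    rw [e]
    have : 0 < pp k * ω * I.len := by positivity
    nlinarith
  | succ n ih =>
    refine (lintegral_dyadicSup_le_maxTest _ .self).trans
      ((h.maxTest_nest_le (m := 0) (fun m hm => ?_) (Nat.zero_le _)).trans (le_of_eq ?_))
    · have hI' := h.nest_plus_minus hm
      exact ih hI' hI'.pos hI'.len_pos
    · congr 1
      rw [show I.nest 0 = I from rfl]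
      norm_num
      ring

/-- The mass of `I_m^{+-}` alone, `3ω|I_m|/4`, dominates the testing integral. Since this piece lies
in both `I_m` and `I_m^+`, one estimate settles both intervals. -/
theorem maxTest_nest_le_mul (h : IsWeight k (n + 1) ω I W) (hm : m < k - 1) :
    maxTest W (ENNReal.ofReal (2 * ω)) (I.nest m) ≤
      ENNReal.ofReal (3 * (pp k * 4 ^ k)) * ∫⁻ x in (I.nest m).plus.minus.toSet, W x := by
  have hp := h.pp_pos
  have hω := h.pos
  have hl := h.len_nest_pos m
  have h16 := sixteen_le h.two_le
  have h4 := h.four_mul_four_pow_le hm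
  refine (h.maxTest_nest_le (fun m hm => (h.nest_plus_minus hm).lintegral_dyadicSup_le)
    hm.le).trans ?_
  rw [(h.nest_plus_minus hm).lintegral_eq_and.1, ← ENNReal.ofReal_mul (by positivity)]
  refine ENNReal.ofReal_le_ofReal ?_
  simp only [len_minus, len_plus]
  have hy : 0 ≤ ω * pp k * (I.nest m).len := by positivity
  have hz : 0 ≤ 9 / 4 * (4 : ℝ) ^ k - (4 * ((7 + 2 * 4 ^ m) / 9) + (4 ^ k - 4 * 4 ^ m)) := by
    have : (0 : ℝ) < 4 ^ m := by positivity
    linarith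
  rw [← sub_nonneg]
  refine le_of_le_of_eq (mul_nonneg hy hz) ?_
  ring

/-- There is no copy inside `I_{k-1}`: the weight, hence its maximal function, is at most `ω/p`, and
the left half carries enough mass. -/
theorem testing_last (h : IsWeight k (n + 1) ω I W) :
    ∫⁻ x in (I.nest (k - 1)).toSet, dyadicSup (avg W) (I.nest (k - 1)) x ^ 2 * (W x)⁻¹ ≤
      ENNReal.ofReal (3 * (pp k * 4 ^ k)) * ∫⁻ x in (I.nest (k - 1)).toSet, W x := by
  have hp := h.pp_pos
  have hω := h.pos
  have hl := h.len_nest_pos (k - 1)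
  have h16 := sixteen_le h.two_le
  have h2p := two_le_pp h.two_le
  calc _ ≤ ENNReal.ofReal ((ω / pp k) ^ 2 *
        (pp k / ω * ((7 + 2 * 4 ^ (k - 1)) / 9) * (I.nest (k - 1)).len)) :=
        (lintegral_dyadicSup_le_maxTest _ .self).trans
          (maxTest_le_of_forall_le (by positivity) h.le_of_mem_last
            (h.lintegral_inv_nest le_rfl).le)
    _ ≤ ENNReal.ofReal (3 * (pp k * 4 ^ k)) * ∫⁻ x in (I.nest (k - 1)).minus.toSet, W x := by
        rw [lintegral_of_const (by positivity) (h.nest_minus le_rfl),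
          ← ENNReal.ofReal_mul (by positivity), h.four_pow_pred, len_minus]
        refine ENNReal.ofReal_le_ofReal ?_
        have e : (ω / pp k) ^ 2 *
            (pp k / ω * ((7 + 2 * (4 ^ k / 4)) / 9) * (I.nest (k - 1)).len) =
            (ω / pp k * (I.nest (k - 1)).len) * ((7 + 4 ^ k / 2) / 9) := by
          field_simp
          ring
        have hy : 0 < ω / pp k * (I.nest (k - 1)).len := by positivity
        have hz : (7 + (4 : ℝ) ^ k / 2) / 9 ≤ 3 * (pp k * 4 ^ k) / 2 := by nlinarith
        rw [e]
        calc _ ≤ _ := mul_le_mul_of_nonneg_left hz hy.le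
          _ = _ := by ring
    _ ≤ _ := mul_le_mul_right (lintegral_mono_set (minus_subset _)) _

/-- The testing condition on all dyadic intervals. -/
theorem testing (h : IsWeight k n ω I W) {J : HOInterval} (hJ : I.Dyadic J) :
    ∫⁻ x in J.toSet, dyadicSup (avg W) J x ^ 2 * (W x)⁻¹ ≤
      ENNReal.ofReal (3 * (pp k * 4 ^ k)) * ∫⁻ x in J.toSet, W x := by
  have hp := h.pp_pos
  have h2p := two_le_pp h.two_le
  have h16 := sixteen_le h.two_le
  have hone : 1 ≤ ENNReal.ofReal (3 * (pp k * 4 ^ k)) := by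
    rw [ENNReal.one_le_ofReal]
    nlinarith
  have hconst : ∀ {c : ℝ} {A J : HOInterval}, 0 < c → (∀ x ∈ A.toSet, W x = ENNReal.ofReal c) →
      A.Dyadic J → ∫⁻ x in J.toSet, dyadicSup (avg W) J x ^ 2 * (W x)⁻¹ ≤
        ENNReal.ofReal (3 * (pp k * 4 ^ k)) * ∫⁻ x in J.toSet, W x := fun hc hA hJ =>
    (lintegral_dyadicSup_of_const hc fun x hx => hA x (hJ.subset hx)).trans
      (le_mul_of_one_le_left zero_le hone)
  induction n generalizing ω I J with
  | zero =>
    obtain ⟨h1, h2, -⟩ := h.base_coeff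
    rcases dyadic_cases hJ with rfl | hJ | hJ
    · have := h.pos
      have := h.len_pos
      refine h.lintegral_dyadicSup_le.trans ?_
      rw [h.lintegral_eq_and.1, ← ENNReal.ofReal_mul (by positivity)]
      refine ENNReal.ofReal_le_ofReal ?_
      have : 0 < pp k * 4 ^ k * ω * J.len := by positivity
      nlinarith
    · exact hconst h1 h.minus_zero hJ
    · exact hconst h2 h.plus_zero hJ
  | succ n ih =>
    have hω := h.pos
    have ht := tau_pos k
    -- A dyadic interval inside `I_m` is `I_m` or `I_m^+`, or lies in `I_m^-` (constant weight), in
    -- a copy `I_m^{+-}` (induction on `n`), or in `I_{m+1}` (induction on `j`).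
    suffices H : ∀ j m, k - 1 = m + j → ∀ J, (I.nest m).Dyadic J →
        ∫⁻ x in J.toSet, dyadicSup (avg W) J x ^ 2 * (W x)⁻¹ ≤
          ENNReal.ofReal (3 * (pp k * 4 ^ k)) * ∫⁻ x in J.toSet, W x from
      H (k - 1) 0 (by simp) J hJ
    intro j
    induction j with
    | zero =>
      intro m hm J hJ
      obtain rfl : m = k - 1 := by omega
      rcases dyadic_cases hJ with rfl | hJ | hJ
      · exact h.testing_last
      · exact hconst (by positivity) (h.nest_minus le_rfl) hJ
      · exact hconst (by positivity) h.nest_plus hJ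
    | succ j ihj =>
      intro m hm J hJ
      have hm' : m < k - 1 := by omega
      rcases dyadic_cases hJ with rfl | hJ | hJ
      · exact (lintegral_dyadicSup_le_maxTest _ .self).trans ((h.maxTest_nest_le_mul hm').trans
          (mul_le_mul_right (lintegral_mono_set ((minus_subset _).trans (plus_subset _))) _))
      · exact hconst (by positivity) (h.nest_minus hm'.le) hJ
      · rcases dyadic_cases hJ with rfl | hJ | hJ
        · exact (lintegral_dyadicSup_le_maxTest _ (dyadic_plus _)).trans
            ((h.maxTest_nest_le_mul hm').trans
              (mul_le_mul_right (lintegral_mono_set (minus_subset _)) _))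
        · exact ih (h.nest_plus_minus hm') hJ
        · exact ihj (m + 1) (by omega) J hJ

/-- A dyadic interval on which the product of the averages of the weight and of its inverse is
of the order of `p ^ 2`. -/
theorem exists_le_avg_mul_avg (h : IsWeight k (n + 1) ω I W) :
    ∃ J, I.Dyadic J ∧ ENNReal.ofReal (pp k ^ 2 / 20) ≤ avg W J * avg (fun x => (W x)⁻¹) J := by
  have hp := h.pp_pos
  have hω := h.pos
  have h16 := sixteen_le h.two_le
  have h2k := h.two_le
  -- This is the last `I_m` containing a copy: that quarter of average `3ω` keeps the average at
  -- least `3ω/4`, while the inverse average is largest so late in the chain.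
  refine ⟨I.nest (k - 2), Dyadic.nest I _, ?_⟩
  have hl := h.len_nest_pos (k - 2)
  have hm : k - 2 < k - 1 := by omega
  have e : 4 * (4 : ℝ) ^ (k - 2) = 4 ^ k / 4 := by
    rw [← h.four_pow_pred, show k - 1 = k - 2 + 1 by omega, pow_succ, mul_comm]
  have hI' := h.nest_plus_minus hm
  have h1 : ENNReal.ofReal (3 * ω / 4) ≤ avg W (I.nest (k - 2)) := by
    refine le_avg hl (by positivity) (le_trans (le_of_eq ?_)
      (lintegral_mono_set ((minus_subset _).trans (plus_subset _))))
    rw [hI'.lintegral_eq_and.1, len_minus, len_plus]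
    congr 1
    ring
  have h2 : ENNReal.ofReal (pp k / ω * ((7 + 2 * 4 ^ (k - 2)) / 9)) ≤
      avg (fun x => (W x)⁻¹) (I.nest (k - 2)) :=
    le_avg hl (by positivity) (h.lintegral_inv_nest hm.le).ge
  refine le_trans ?_ (mul_le_mul' h1 h2)
  rw [← ENNReal.ofReal_mul (by positivity)]
  refine ENNReal.ofReal_le_ofReal ?_
  have e' : 3 * ω / 4 * (pp k / ω * ((7 + 2 * 4 ^ (k - 2)) / 9)) =
      pp k * ((7 + 4 ^ k / 8) / 12) := by
    rw [show (4 : ℝ) ^ (k - 2) = 4 ^ k / 16 by linarith]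
    field_simp
    ring
  rw [e']
  have := pp_le h.two_le
  have h3 : pp k / 20 ≤ (7 + 4 ^ k / 8) / 12 := by linarith
  nlinarith

end IsWeight

end DyadicWeight

/-! ### The operator norm, the testing condition and the characteristic. -/

namespace HOInterval

theorem eLpNorm_two_sq {α ε : Type*} [MeasurableSpace α] [TopologicalSpace ε]
    [ContinuousENorm ε] (f : α → ε) (μ : Measure α) :
    eLpNorm f 2 μ ^ 2 = ∫⁻ x, ‖f x‖ₑ ^ 2 ∂μ := by
  have := eLpNorm_nnreal_pow_eq_lintegral (f := f) (μ := μ) (p := 2) two_ne_zero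
  simpa using this

variable {I : HOInterval} {w : ℝ → ℝ}

theorem lintegral_invMeasure (hw : Measurable w) {F : ℝ → ℝ≥0∞} (hF : Measurable F) :
    ∫⁻ x, F x ∂invMeasure I w = ∫⁻ x in I.toSet, F x * (ENNReal.ofReal (w x))⁻¹ := by
  have hm : Measurable fun x => (ENNReal.ofReal (w x))⁻¹ := hw.ennreal_ofReal.inv
  rw [invMeasure, lintegral_withDensity_eq_lintegral_mul _ hm hF]
  simp [mul_comm]

theorem eLpNorm_dyadicMax_sq (hw : Measurable w) (f : ℝ → ℝ) :
    eLpNorm (dyadicMax I f) 2 (invMeasure I w) ^ 2 =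
      ∫⁻ x in I.toSet, dyadicSup (avg fun y => ‖f y‖ₑ) I x ^ 2 * (ENNReal.ofReal (w x))⁻¹ := by
  rw [eLpNorm_two_sq]
  exact lintegral_invMeasure hw ((measurable_dyadicSup _ I).pow_const 2)

/-- The dyadic characteristic is at most the square of the norm of the maximal operator. -/
theorem dyadicA2_le_dyadicMaxNorm_sq (hw : Measurable w) (hI : 0 < I.len)
    (hfin : ∫⁻ x in I.toSet, ENNReal.ofReal (w x) ≠ ∞)
    (hw0 : ∀ᵐ x ∂volume.restrict I.toSet, ENNReal.ofReal (w x) ≠ 0) :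
    dyadicA2 I w ≤ dyadicMaxNorm I w ^ 2 := by
  refine iSup_le fun J => iSup_le fun hJ => ?_
  set W : ℝ → ℝ≥0∞ := fun x => ENNReal.ofReal (w x) with hWdef
  have hW : Measurable W := hw.ennreal_ofReal
  change avg W J * avg (fun x => (W x)⁻¹) J ≤ _
  have hJ0 : ENNReal.ofReal J.len ≠ 0 := by simpa using hJ.len_pos hI
  have hJt : ENNReal.ofReal J.len ≠ ∞ := ENNReal.ofReal_ne_top
  have hWJt : ∫⁻ x in J.toSet, W x ≠ ∞ :=
    ne_top_of_le_ne_top hfin (lintegral_mono_set hJ.subset)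
  have hWJ0 : ∫⁻ x in J.toSet, W x ≠ 0 := lintegral_dyadic_ne_zero hW hI hw0 hJ
  -- For `f = w χ_J` the squared norm is `w(J)`, while `M^d f` is at least the average of `w` on
  -- `J`.
  set f : ℝ → ℝ := J.toSet.indicator fun x => (W x).toReal with hf
  have hfm : Measurable f := hW.ennreal_toReal.indicator J.measurableSet_toSet
  have hfe : ∀ x, ‖f x‖ₑ = J.toSet.indicator W x := fun x => by
    by_cases hx : x ∈ J.toSet
    · simp [hf, hx, hWdef]
    · simp [hf, hx]
  have hWt : ∀ x, W x ≠ ∞ := fun x => ENNReal.ofReal_ne_top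
  have hfn : eLpNorm f 2 (invMeasure I w) ^ 2 = ∫⁻ x in J.toSet, W x := by
    rw [eLpNorm_two_sq, lintegral_invMeasure hw (hfm.enorm.pow_const 2),
      ← inter_eq_left.2 hJ.subset, ← Measure.restrict_restrict J.measurableSet_toSet,
      ← lintegral_indicator J.measurableSet_toSet]
    refine lintegral_congr_ae ?_
    filter_upwards [hw0] with x hx
    by_cases hxJ : x ∈ J.toSet
    · rw [hfe, indicator_of_mem hxJ, sq, mul_assoc]
      change W x * (W x * (W x)⁻¹) = W x
      rw [ENNReal.mul_inv_cancel hx (hWt x), mul_one]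
    · simp [hfe, hxJ]
  have hMem : MemLp f 2 (invMeasure I w) := by
    refine ⟨hfm.aestronglyMeasurable, lt_top_iff_ne_top.2 fun htop => ?_⟩
    rw [htop] at hfn
    exact hWJt (by rw [← hfn]; simp)
  have hMf : avg W J ^ 2 * ∫⁻ x in J.toSet, (W x)⁻¹ ≤
      eLpNorm (dyadicMax I f) 2 (invMeasure I w) ^ 2 := by
    rw [eLpNorm_dyadicMax_sq hw]
    refine le_trans ?_ (lintegral_mono_set hJ.subset)
    refine (lintegral_const_mul_le _ _).trans
      (setLIntegral_mono' J.measurableSet_toSet fun x hx => ?_)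
    gcongr
    refine le_trans (le_of_eq ?_) (le_dyadicSup _ hJ hx)
    rw [avg_eq, avg_eq]
    congr 1
    exact setLIntegral_congr_fun J.measurableSet_toSet fun y hy => by
      rw [hfe, indicator_of_mem hy]
  -- The norm is an infimum, so the square root of the product is compared with each admissible
  -- constant.
  have key : (avg W J * avg (fun x => (W x)⁻¹) J) ^ (2⁻¹ : ℝ) ≤ dyadicMaxNorm I w := by
    refine le_sInf fun C hC => ?_
    rw [ENNReal.rpow_inv_le_iff (by norm_num), ENNReal.rpow_two]
    have h1 : avg W J ^ 2 * ∫⁻ x in J.toSet, (W x)⁻¹ ≤ C ^ 2 * ∫⁻ x in J.toSet, W x := by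
      refine hMf.trans ?_
      rw [← hfn, ← mul_pow]
      exact pow_le_pow_left' (hC f hMem) 2
    have h2 : ∀ G : ℝ → ℝ≥0∞, ∫⁻ x in J.toSet, G x = avg G J * ENNReal.ofReal J.len := fun G => by
      rw [avg_eq, ENNReal.div_mul_cancel hJ0 hJt]
    have h3 : (avg W J * avg (fun x => (W x)⁻¹) J) * ∫⁻ x in J.toSet, W x ≤
        C ^ 2 * ∫⁻ x in J.toSet, W x := by
      refine le_trans (le_of_eq ?_) h1
      rw [h2 W, h2 fun x => (W x)⁻¹]
      ring
    exact (ENNReal.mul_le_mul_iff_left hWJ0 hWJt).1 h3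
  calc _ = ((avg W J * avg (fun x => (W x)⁻¹) J) ^ (2⁻¹ : ℝ)) ^ 2 := by
        rw [← ENNReal.rpow_two, ← ENNReal.rpow_mul]
        norm_num
    _ ≤ _ := pow_le_pow_left' key 2

/-- The testing condition bounds the norm of the maximal operator. -/
theorem dyadicMaxNorm_le (hw : Measurable w) (hI : 0 < I.len)
    (hfin : ∫⁻ x in I.toSet, ENNReal.ofReal (w x) ≠ ∞)
    (hw0 : ∀ᵐ x ∂volume.restrict I.toSet, ENNReal.ofReal (w x) ≠ 0) {K C : ℝ≥0∞}
    (hKC : 32 * K ≤ C ^ 2)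
    (h : ∀ J, I.Dyadic J → ∫⁻ x in J.toSet, dyadicSup (avg fun x => ENNReal.ofReal (w x)) J x ^ 2 *
      (ENNReal.ofReal (w x))⁻¹ ≤ K * ∫⁻ x in J.toSet, ENNReal.ofReal (w x)) :
    dyadicMaxNorm I w ≤ C := by
  refine sInf_le fun f hf => ?_
  obtain ⟨g, hg, hfg⟩ := hf.1
  -- The density `w⁻¹` vanishes nowhere, so replacing `f` by a measurable representative leaves all
  -- Lebesgue averages unchanged.
  have hac : volume.restrict I.toSet ≪ invMeasure I w :=
    withDensity_absolutelyContinuous' hw.ennreal_ofReal.inv.aemeasurable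
      (Filter.Eventually.of_forall fun x => ENNReal.inv_ne_zero.2 ENNReal.ofReal_ne_top)
  have hfg' : f =ᵐ[volume.restrict I.toSet] g := hac.ae_le hfg
  have hgm : Measurable fun x => ‖g x‖ₑ := hg.measurable.enorm
  have hMfg : ∀ x, dyadicSup (avg fun y => ‖f y‖ₑ) I x ≤ dyadicSup (avg fun y => ‖g y‖ₑ) I x :=
    fun x => dyadicSup_le fun J hJ hx => by
      refine le_trans (le_of_eq ?_) (le_dyadicSup _ hJ hx)
      rw [avg_eq, avg_eq]
      congr 1
      refine lintegral_congr_ae ?_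
      filter_upwards [ae_restrict_of_ae_restrict_of_subset hJ.subset hfg'] with y hy
      rw [hy]
  rw [← ENNReal.pow_le_pow_left_iff two_ne_zero, mul_pow,
    eLpNorm_dyadicMax_sq hw, eLpNorm_congr_ae hfg, eLpNorm_two_sq,
    lintegral_invMeasure hw (hgm.pow_const 2)]
  calc _ ≤ ∫⁻ x in I.toSet,
        dyadicSup (avg fun y => ‖g y‖ₑ) I x ^ 2 * (ENNReal.ofReal (w x))⁻¹ := by
        gcongr with x
        exact hMfg x
    _ ≤ _ := lintegral_dyadicSup_avg_sq_le hw.ennreal_ofReal hgm hI hfin hw0 h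
    _ ≤ _ := by gcongr

end HOInterval

/-! ### The constants on the unit interval. -/

namespace DyadicWeight

open HOInterval

theorem isWeight_unitInt {k : ℕ} (hk : 2 ≤ k) (n : ℕ) :
    IsWeight k n 1 unitInt fun x => ENNReal.ofReal (w k n 1 unitInt x) :=
  ⟨hk, one_pos, one_pos, fun _ _ => rfl⟩

theorem IsWeight.ae_ne_zero {k n : ℕ} {ω : ℝ} {I : HOInterval} {W : ℝ → ℝ≥0∞}
    (h : IsWeight k n ω I W) (hW : Measurable W) : ∀ᵐ x ∂volume.restrict I.toSet, W x ≠ 0 := by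
  have h1 : ∫⁻ x in I.toSet, (W x)⁻¹ ≠ ∞ := by
    rw [h.lintegral_eq_and.2]
    exact ENNReal.ofReal_ne_top
  filter_upwards [ae_lt_top hW.inv h1] with x hx
  simpa using hx.ne

theorem IsWeight.lintegral_ne_top {k n : ℕ} {ω : ℝ} {I : HOInterval} {W : ℝ → ℝ≥0∞}
    (h : IsWeight k n ω I W) : ∫⁻ x in I.toSet, W x ≠ ∞ := by
  rw [h.lintegral_eq_and.1]
  exact ENNReal.ofReal_ne_top

theorem dyadicMaxNorm_w_le {k : ℕ} (hk : 2 ≤ k) (n : ℕ) :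
    dyadicMaxNorm unitInt (w k n 1 unitInt) ≤ ENNReal.ofReal (28 * pp k) := by
  have h := isWeight_unitInt hk n
  have hm := measurable_w k n 1 unitInt
  have hp := h.pp_pos
  have hle := le_pp hk
  refine dyadicMaxNorm_le hm h.len_pos h.lintegral_ne_top (h.ae_ne_zero hm.ennreal_ofReal)
    ?_ fun J hJ => h.testing hJ
  rw [← ENNReal.ofReal_pow (by positivity), ← ENNReal.ofReal_ofNat,
    ← ENNReal.ofReal_mul (by norm_num)]
  refine ENNReal.ofReal_le_ofReal ?_
  -- Since `4^k ≤ 8p`, the left side is at most `32 · 3 · 8 p² = 768 p²`, and `768 ≤ 28²`.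
  nlinarith

theorem le_dyadicA2_w {k : ℕ} (hk : 2 ≤ k) (n : ℕ) :
    ENNReal.ofReal (pp k ^ 2 / 20) ≤ dyadicA2 unitInt (w k (n + 1) 1 unitInt) := by
  obtain ⟨J, hJ, h⟩ := (isWeight_unitInt hk (n + 1)).exists_le_avg_mul_avg
  exact h.trans (le_iSup₂_of_le J hJ le_rfl)

theorem dyadicA2_w_le_dyadicMaxNorm_sq {k : ℕ} (hk : 2 ≤ k) (n : ℕ) :
    dyadicA2 unitInt (w k n 1 unitInt) ≤ dyadicMaxNorm unitInt (w k n 1 unitInt) ^ 2 := by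
  have h := isWeight_unitInt hk n
  have hm := measurable_w k n 1 unitInt
  exact dyadicA2_le_dyadicMaxNorm_sq hm h.len_pos h.lintegral_ne_top
    (h.ae_ne_zero hm.ennreal_ofReal)

end DyadicWeight

theorem theorem3p1 :
    -- the bound for the maximal operator, with an absolute constant
    (∃ A : ℝ, 0 < A ∧ ∀ k : ℕ, 2 ≤ k →
      dyadicMaxNorm unitInt (DyadicWeight.w k (4 ^ k) 1 unitInt)
        ≤ ENNReal.ofReal (A * DyadicWeight.pp k)) ∧
    -- the two-sided comparisons, with absolute constants
    (∃ c C : ℝ, 0 < c ∧ 0 < C ∧ ∀ k : ℕ, 2 ≤ k →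
      (ENNReal.ofReal (c * DyadicWeight.pp k ^ 2)
          ≤ dyadicA2 unitInt (DyadicWeight.w k (4 ^ k) 1 unitInt) ∧
        dyadicA2 unitInt (DyadicWeight.w k (4 ^ k) 1 unitInt)
          ≤ ENNReal.ofReal (C * DyadicWeight.pp k ^ 2)) ∧
      (ENNReal.ofReal (c * DyadicWeight.pp k ^ 2)
          ≤ dyadicMaxNorm unitInt (DyadicWeight.w k (4 ^ k) 1 unitInt) ^ 2 ∧
        dyadicMaxNorm unitInt (DyadicWeight.w k (4 ^ k) 1 unitInt) ^ 2
          ≤ ENNReal.ofReal (C * DyadicWeight.pp k ^ 2))) := by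
  have hpp : ∀ {k : ℕ}, 2 ≤ k → 0 < DyadicWeight.pp k := fun hk => by
    linarith [DyadicWeight.two_le_pp hk]
  have hA2 : ∀ {k : ℕ}, 2 ≤ k → ENNReal.ofReal (1 / 20 * DyadicWeight.pp k ^ 2) ≤
      dyadicA2 unitInt (DyadicWeight.w k (4 ^ k) 1 unitInt) := fun {k} hk => by
    -- The lower bound needs at least one step of the recursion, and `4^k ≠ 0` provides it.
    obtain ⟨n, hn⟩ := Nat.exists_eq_succ_of_ne_zero (pow_ne_zero k (four_ne_zero (α := ℕ)))
    rw [hn, one_div_mul_eq_div]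
    exact DyadicWeight.le_dyadicA2_w hk n
  have hN : ∀ {k : ℕ}, 2 ≤ k → dyadicMaxNorm unitInt (DyadicWeight.w k (4 ^ k) 1 unitInt) ^ 2 ≤
      ENNReal.ofReal (28 ^ 2 * DyadicWeight.pp k ^ 2) := fun {k} hk => by
    have := hpp hk
    rw [← mul_pow, ENNReal.ofReal_pow (by positivity)]
    exact pow_le_pow_left' (DyadicWeight.dyadicMaxNorm_w_le hk _) 2
  have hAN : ∀ {k : ℕ}, 2 ≤ k → dyadicA2 unitInt (DyadicWeight.w k (4 ^ k) 1 unitInt) ≤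
      dyadicMaxNorm unitInt (DyadicWeight.w k (4 ^ k) 1 unitInt) ^ 2 := fun hk =>
    DyadicWeight.dyadicA2_w_le_dyadicMaxNorm_sq hk _
  exact ⟨⟨28, by norm_num, fun k hk => DyadicWeight.dyadicMaxNorm_w_le hk _⟩,
    1 / 20, 28 ^ 2, by norm_num, by norm_num, fun k hk =>
    ⟨⟨hA2 hk, (hAN hk).trans (hN hk)⟩, (hA2 hk).trans (hAN hk), hN hk⟩⟩
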